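/- Let $X=(X_v)_{v\in V}$ be finitely many variables, $X_v$ taking values in a standard Borel space $\Omega_v$ that carries a $\sigma$-finite reference measure $\mu_v$ (for instance Lebesgue or counting measure). A causal model is an acyclic structural causal model on these variables: a directed acyclic graph on $V$, measurable structural assignments $X_v:=f_v(X_{\mathrm{PA}_v},N_v)$ in which $\mathrm{PA}_v$ are the parents of $v$ in the graph, and jointly independent noise variables $N_v$. The intervention $do(X_i=x)$ replaces the assignment of $X_i$ by the constant $x$, and $P^{\mathfrak C}$, $P^{\mathfrak C;do(X_i=x)}$ denote the joint laws of $X$ that the model $\mathfrak C$ entails without and with this intervention. A law $P$ is (globally) Markov with respect to a directed graph $\mathcal G$ if $A\perp_{\mathcal G}B\mid S$ ($d$-separation) implies that $X_A$ and $X_B$ are conditionally independent given $X_S$ under $P$, for all pairwise disjoint $A,B,S\subseteq V$; it is causally minimal with respect to $\mathcal G$ if it is Markov with respect to $\mathcal G$ but not with respect to any proper subgraph of $\mathcal G$ (same nodes, fewer edges). Let $\mathfrak C,\mathfrak D$ be two causal models on the same variables, with causal graphs $\mathcal G,\mathcal H$. Assume that $P^{\mathfrak C}$ satisfies the global Markov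 property and causal minimality with respect to $\mathcal G$, and $P^{\mathfrak D}$ with respect to $\mathcal H$, and that both laws have a strictly positive density with respect to the product measure $\bigotimes_{v}\mu_v$. Suppose that $ID(\mathfrak C,\mathfrak D)=0$, that is, the models agree on all single-node interventions: $$P^{\mathfrak C;do(X_i=x)}=P^{\mathfrak D;do(X_i=x)}\qquad\text{for all } i\in V \text{ and all } x\in\Omega_i .$$ Then $\mathcal G=\mathcal H$. Consequently $SHD(\mathcal G,\mathcal H)=SID(\mathcal G,\mathcal H)=0$. Here the structural Hamming distance $SHD(\mathcal G,\mathcal H)$ is the number of unordered pairs of nodes between which $\mathcal G$ and $\mathcal H$ do not have the same type of edge. The structural intervention distance $SID(\mathcal G,\mathcal H)$ is the number of ordered pairs $(i,j)$ of distinct nodes for which the effect of $i$ on $j$ is falsely inferred by $\mathcal H$ with respect to $\mathcal G$: for some strictly positive joint law $p$ of finitely-valued variables that factorizes along $\mathcal G$, and some values $a,b$, the interventional probability $p_{\mathcal G}(X_j=b\mid do(X_i=a))$ given by the truncated factorization along $\mathcal G$ differs from the value obtained by adjusting for the parents of $i$ in $\mathcal H$, namely $p(X_j=b)$ if $j\in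 \mathrm{PA}^{\mathcal H}_i$ and $\sum_z p(X_j=b\mid X_i=a,X_{\mathrm{PA}^{\mathcal H}_i}=z)\,p(X_{\mathrm{PA}^{\mathcal H}_i}=z)$ otherwise. -/

import Mathlib

open MeasureTheory

universe u w w₁ w₂

namespace CausalModel

/-! ### Graphs and d-separation -/

/-- `b` is a collider between its neighbours `a` and `c` on a path: `a → b ← c`. -/
def IsCollider {V : Type*} (G : Digraph V) (a b c : V) : Prop :=
  G.Adj a b ∧ G.Adj c b

/-- `l` is a path of `G` from `a` to `b`: a list of pairwise distinct nodes, consecutive ones being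
joined by an edge in one direction or the other. -/
def IsPath {V : Type*} (G : Digraph V) (l : List V) (a b : V) : Prop :=
  l.Nodup ∧ l.IsChain (fun x y => G.Adj x y ∨ G.Adj y x) ∧ l.head? = some a ∧ l.getLast? = some b

/-- The path `l` is active (not blocked) given `Z`: every collider on it is in `Z` or has a
descendant in `Z`, and no other inner node of it is in `Z`. -/
def IsActive {V : Type*} (G : Digraph V) (Z : Set V) (l : List V) : Prop :=
  ∀ a b c : V, [a, b, c] <:+: l →
    (IsCollider G a b c → ∃ z ∈ Z, Relation.ReflTransGen G.Adj b z) ∧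
    (¬ IsCollider G a b c → b ∉ Z)

/-- `X` and `Y` are d-separated by `Z` in `G`: every path between them is blocked by `Z`. -/
def DSep {V : Type*} (G : Digraph V) (X Y Z : Set V) : Prop :=
  ∀ x ∈ X, ∀ y ∈ Y, ∀ l : List V, IsPath G l x y → ¬ IsActive G Z l

/-! ### Markov property, causal minimality, positivity -/

/-- The σ-algebra on the space of joint values generated by the variables in `S`. -/
abbrev coordSigma {V : Type*} (Ω : V → Type u) [∀ v, MeasurableSpace (Ω v)] (S : Set V) :
    MeasurableSpace (∀ v, Ω v) :=
  ⨆ v ∈ S, MeasurableSpace.comap (fun x : ∀ v, Ω v => x v) inferInstance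

theorem coordSigma_le {V : Type*} (Ω : V → Type u) [∀ v, MeasurableSpace (Ω v)] (S : Set V) :
    coordSigma Ω S ≤ (inferInstance : MeasurableSpace (∀ v, Ω v)) :=
  iSup₂_le fun v _ => (measurable_pi_apply v).comap_le

/-- The global Markov property of a joint law `P` with respect to `G`: for pairwise disjoint sets of
variables, d-separation in `G` implies conditional independence under `P`. -/
def GlobalMarkov {V : Type*} [Fintype V] {Ω : V → Type u} [∀ v, MeasurableSpace (Ω v)]
    [∀ v, StandardBorelSpace (Ω v)] (G : Digraph V) (P : Measure (∀ v, Ω v))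
    [IsFiniteMeasure P] : Prop :=
  ∀ X Y Z : Set V, Disjoint X Y → Disjoint X Z → Disjoint Y Z → DSep G X Y Z →
    ProbabilityTheory.CondIndep (coordSigma Ω Z) (coordSigma Ω X) (coordSigma Ω Y)
      (coordSigma_le Ω Z) P

/-- Causal minimality: `P` is Markov with respect to `G`, but not with respect to any proper
subgraph of `G` (same nodes, fewer edges). -/
def CausallyMinimal {V : Type*} [Fintype V] {Ω : V → Type u} [∀ v, MeasurableSpace (Ω v)]
    [∀ v, StandardBorelSpace (Ω v)] (G : Digraph V) (P : Measure (∀ v, Ω v))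
    [IsFiniteMeasure P] : Prop :=
  GlobalMarkov G P ∧ ∀ G' : Digraph V, G' < G → ¬ GlobalMarkov G' P

/-- `P` has a strictly positive density with respect to the product of the measures `μ v`. -/
def HasPositiveDensity {V : Type*} [Fintype V] {Ω : V → Type u} [∀ v, MeasurableSpace (Ω v)]
    (μ : ∀ v, Measure (Ω v)) (P : Measure (∀ v, Ω v)) : Prop :=
  ∃ p : (∀ v, Ω v) → ENNReal, Measurable p ∧ (∀ x, 0 < p x) ∧
    P = (Measure.pi μ).withDensity p

end CausalModel

/-! ### Structural causal models -/

/-- A structural causal model with variables `X v ∈ Ω v`, `v ∈ V`: an acyclic causal graph, jointly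
independent noise variables `N v` with laws `noiseLaw v`, and structural assignments
`X v := assign v (values of the parents of v) (N v)`. -/
structure SCM (V : Type*) (Ω : V → Type u) [∀ v, MeasurableSpace (Ω v)] where
  graph : Digraph V
  acyclic : ∀ v, ¬ Relation.TransGen graph.Adj v v
  Noise : V → Type w
  [noiseMeasurableSpace : ∀ v, MeasurableSpace (Noise v)]
  noiseLaw : ∀ v, Measure (Noise v)
  [noiseIsProbability : ∀ v, IsProbabilityMeasure (noiseLaw v)]
  assign : ∀ v, (∀ p : {p : V // graph.Adj p v}, Ω p) → Noise v → Ω v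
  measurable_assign : ∀ v, Measurable (Function.uncurry (assign v))

namespace SCM

attribute [instance] SCM.noiseMeasurableSpace SCM.noiseIsProbability

variable {V : Type*} {Ω : V → Type u} [∀ v, MeasurableSpace (Ω v)]

theorem wellFounded [Finite V] (C : SCM.{u, w} V Ω) : WellFounded C.graph.Adj := by
  have : IsTrans V (Relation.TransGen C.graph.Adj) := ⟨fun _ _ _ => Relation.TransGen.trans⟩
  have : Std.Irrefl (Relation.TransGen C.graph.Adj) := ⟨C.acyclic⟩
  exact Subrelation.wf (fun h => Relation.TransGen.single h)
    (Finite.wellFounded_of_trans_of_irrefl (Relation.TransGen C.graph.Adj))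

/-- The joint value of all variables when the noise takes the value `n` and the assignment of each
variable `v` with `a v = some x` is replaced by the constant assignment `X v := x`. -/
noncomputable def solve [Finite V] (C : SCM.{u, w} V Ω) (a : ∀ v, Option (Ω v))
    (n : ∀ v, C.Noise v) : ∀ v, Ω v :=
  C.wellFounded.fix fun v ih => (a v).getD (C.assign v (fun p => ih p.1 p.2) (n v))

theorem solve_eq [Finite V] (C : SCM.{u, w} V Ω) (a : ∀ v, Option (Ω v))
    (n : ∀ v, C.Noise v) (v : V) :
    C.solve a n v = (a v).getD (C.assign v (fun p => C.solve a n p.1) (n v)) := by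
  unfold solve
  rw [WellFounded.fix_eq]

theorem measurable_solve [Finite V] (C : SCM.{u, w} V Ω) (a : ∀ v, Option (Ω v)) :
    Measurable (C.solve a) := by
  refine measurable_pi_lambda _ fun v => ?_
  induction v using C.wellFounded.induction with
  | _ v ih =>
    simp only [solve_eq C a _ v]
    cases a v with
    | some x => exact measurable_const
    | none =>
      exact (C.measurable_assign v).comp
        ((measurable_pi_lambda _ fun p => ih p.1 p.2).prodMk (measurable_pi_apply v))

/-- The joint law of all variables under the intervention encoded by `a`. -/
noncomputable def law [Fintype V] (C : SCM.{u, w} V Ω) (a : ∀ v, Option (Ω v)) :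
    Measure (∀ v, Ω v) :=
  (Measure.pi C.noiseLaw).map (C.solve a)

instance [Fintype V] (C : SCM.{u, w} V Ω) (a : ∀ v, Option (Ω v)) :
    IsProbabilityMeasure (C.law a) :=
  Measure.isProbabilityMeasure_map (C.measurable_solve a).aemeasurable

/-- The observational law `P^C`. -/
noncomputable abbrev obsLaw [Fintype V] (C : SCM.{u, w} V Ω) : Measure (∀ v, Ω v) :=
  C.law fun _ => none

/-- The interventional law `P^{C; do(X_i = x)}`. -/
noncomputable abbrev doLaw [Fintype V] [DecidableEq V] (C : SCM.{u, w} V Ω) (i : V) (x : Ω i) :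
    Measure (∀ v, Ω v) :=
  C.law (Function.update (fun _ => none) i (some x))

end SCM

namespace CausalModel

/-- `ID(C, D) = 0`: the two models entail the same joint law under every single-node intervention
`do(X_i = x)`. -/
def InterventionalDistanceZero {V : Type*} [Fintype V] [DecidableEq V] {Ω : V → Type u}
    [∀ v, MeasurableSpace (Ω v)] (C : SCM.{u, w₁} V Ω) (D : SCM.{u, w₂} V Ω) : Prop :=
  ∀ (i : V) (x : Ω i), C.doLaw i x = D.doLaw i x

/-! ### Structural Hamming distance and structural intervention distance -/

/-- Structural Hamming distance: the number of unordered pairs of nodes between which `G` and `H` do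
not have the same type of edge (so a reversed edge counts once). -/
noncomputable def SHD {V : Type*} (G H : Digraph V) : ℕ :=
  Set.ncard {e : Sym2 V | ∃ i j : V, e = s(i, j) ∧
    ¬ ((G.Adj i j ↔ H.Adj i j) ∧ (G.Adj j i ↔ H.Adj j i))}

section FiniteLaws

open scoped Classical

/-- The probability of the event `A` under the probability mass function `p`. -/
noncomputable def prob {V : Type*} [Fintype V] {m : V → ℕ} (p : (∀ v, Fin (m v)) → ℝ)
    (A : Set (∀ v, Fin (m v))) : ℝ :=
  ∑ y ∈ Finset.univ.filter (· ∈ A), p y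

/-- The event that the parents of `k` in `G` take the values that they have in `x`. -/
def parentsEvent {V : Type*} {m : V → ℕ} (G : Digraph V) (k : V)
    (x : ∀ v, Fin (m v)) : Set (∀ v, Fin (m v)) :=
  {y | ∀ v, G.Adj v k → y v = x v}

/-- The conditional probability `p(x_k | x_{PA_k})`, with the parents of `k` taken in `G`. -/
noncomputable def condParents {V : Type*} [Fintype V] {m : V → ℕ} (p : (∀ v, Fin (m v)) → ℝ)
    (G : Digraph V) (k : V) (x : ∀ v, Fin (m v)) : ℝ :=
  prob p ({y | y k = x k} ∩ parentsEvent G k x) / prob p (parentsEvent G k x)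

/-- `p` is a strictly positive probability mass function which factorizes along `G`, that is,
`p(x) = ∏_k p(x_k | x_{PA_k})`. -/
def IsPositiveMarkovPMF {V : Type*} [Fintype V] {m : V → ℕ} (p : (∀ v, Fin (m v)) → ℝ)
    (G : Digraph V) : Prop :=
  (∀ x, 0 < p x) ∧ ∑ x, p x = 1 ∧ ∀ x, p x = ∏ k, condParents p G k x

/-- The interventional probability `p_G(X_j = b | do(X_i = a))`, by the truncated factorization. -/
noncomputable def doProb {V : Type*} [Fintype V] {m : V → ℕ} (p : (∀ v, Fin (m v)) → ℝ)
    (G : Digraph V) (i j : V) (a : Fin (m i)) (b : Fin (m j)) : ℝ :=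
  ∑ y ∈ Finset.univ.filter (fun y : ∀ v, Fin (m v) => y i = a ∧ y j = b),
    ∏ k ∈ Finset.univ.filter (· ≠ i), condParents p G k y

/-- What `p_H(X_j = b | do(X_i = a))` is inferred to be by adjusting for the parents of `i` in `H`:
`p(b)` if `j` is one of these parents, and `∑_z p(b | a, z) p(z)` otherwise, where `z` runs through
the joint values of these parents. -/
noncomputable def adjustProb {V : Type*} [Fintype V] {m : V → ℕ} (p : (∀ v, Fin (m v)) → ℝ)
    (H : Digraph V) (i j : V) (a : Fin (m i)) (b : Fin (m j)) : ℝ :=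
  if H.Adj j i then prob p {y | y j = b}
  else ∑ z : ∀ v : {v : V // H.Adj v i}, Fin (m v),
    prob p {y | y j = b ∧ y i = a ∧ ∀ v, y v.1 = z v} /
      prob p {y | y i = a ∧ ∀ v, y v.1 = z v} * prob p {y | ∀ v, y v.1 = z v}

end FiniteLaws

/-- Structural intervention distance: the number of ordered pairs `(i, j)` of distinct nodes for
which the effect of interventions on `i` on the variable `j` is falsely inferred by `H` with respect
to `G`, that is, for some positive joint law that is Markov with respect to `G`, adjusting for the
parents of `i` in `H` does not give the interventional law of `j` in `G`. -/
noncomputable def SID {V : Type*} [Fintype V] (G H : Digraph V) : ℕ :=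
  Set.ncard {e : V × V | e.1 ≠ e.2 ∧
    ∃ (m : V → ℕ) (p : (∀ v, Fin (m v)) → ℝ), IsPositiveMarkovPMF p G ∧
      ∃ (a : Fin (m e.1)) (b : Fin (m e.2)),
        adjustProb p H e.1 e.2 a b ≠ doProb p G e.1 e.2 a b}

end CausalModel

/-!
Two acyclic structural causal models with the same single-node interventional laws, both with a
positive density and causally minimal, have the same graph. The graphs are compared on sets `W` of
nodes that are ancestral in both of them, starting from all nodes and removing one common sink at a
time.

A sink `j` of the first graph within `W` can be recognized from interventions: intervening on `j`
does not change the joint law of the other variables of `W`. If the second graph had an edge from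
`j` to some `k ∈ W`, the conditional law of `k` given its predecessors would, under every
`do(X_j = x)`, be one and the same function of the other predecessors
(`SCM.sink_of_interventionalDistanceZero`). For a common sink `j` of `W`, both models compute the
conditional law of `j` given the rest of `W`, each as a function of its own parents of `j`. If `i`
is a parent in one model only, the assignment of `j` in that model coincides under all
interventions on `i` with a function that ignores `i` (`SCM.adj_of_interventionalDistanceZero`).

In both cases an edge `i → k` turns out to be superfluous, which contradicts causal minimality
(`SCM.false_of_assignProb_ae_eq`). This takes two facts.

* What holds almost surely under all interventions on `i` holds almost surely under the
  observational law (`SCM.ae_obsLaw_of_forall_ae_doLaw`). Here positivity enters: given its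
  non-descendants, `X_i` is absolutely continuous with respect to the reference measure.
* A law under which each variable is screened off by its parents from its predecessors is globally
  Markov (`CausalModel.globalMarkov_of_local`). The induction removes a sink `j` at a time and uses
  the semigraphoid rules. If `j` is to be separated, so are its parents, which screen it off. If
  `j` is conditioned on, one of the two separated sets is also separated from `j`; otherwise two
  active paths ending in `j` could be joined at their first common node
  (`CausalModel.exists_isActive_join`).

For equal graphs the structural Hamming distance vanishes trivially, and the structural intervention
distance vanishes because adjusting for the true parents is correct
(`CausalModel.adjustProb_eq_doProb`).
-/

namespace CausalModel

/-! ### Paths and d-separation when a sink is removed -/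

section Graph

variable {V : Type*} {G G₀ : Digraph V} {X Y Z : Set V} {l : List V} {j x y : V}

theorem IsPath.reverse (h : IsPath G l x y) : IsPath G l.reverse y x := by
  obtain ⟨h1, h2, h3, h4⟩ := h
  refine ⟨List.nodup_reverse.2 h1, ?_, by simpa using h4, by simpa using h3⟩
  rw [List.isChain_reverse]
  exact h2.imp fun _ _ h => h.symm

theorem IsActive.reverse (h : IsActive G Z l) : IsActive G Z l.reverse := by
  intro a b c habc
  have h' : [c, b, a] <:+: l := by
    have := List.reverse_infix.2 habc
    simpa using this
  have := h c b a h'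
  exact ⟨fun hc => this.1 ⟨hc.2, hc.1⟩, fun hc => this.2 fun hc' => hc ⟨hc'.2, hc'.1⟩⟩

theorem IsActive.of_infix {l' : List V} (h : IsActive G Z l) (hl : l' <:+: l) : IsActive G Z l' :=
  fun a b c habc => h a b c (habc.trans hl)

theorem DSep.symm (h : DSep G X Y Z) : DSep G Y X Z :=
  fun y hy x hx _ hl ha => h x hx y hy _ hl.reverse ha.reverse

/-- A common node would be an active path by itself. -/
theorem DSep.disjoint (h : DSep G X Y Z) : Disjoint X Y := by
  refine Set.disjoint_left.2 fun x hX hY => h x hX x hY [x] ⟨by simp, by simp, rfl, rfl⟩ ?_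
  intro a b c habc
  have := habc.length_le
  simp at this

theorem DSep.union_right {Y' : Set V} (h : DSep G X Y Z) (h' : DSep G X Y' Z) :
    DSep G X (Y ∪ Y') Z :=
  fun x hx y hy => hy.elim (h x hx y) (h' x hx y)

/-- Three consecutive members of `l₁ ++ c :: l₂` lie in `l₁` and `c`, or in `c` and `l₂`, or have
`c` in the middle. -/
theorem triple_infix_append {a b d c : V} {l₁ l₂ : List V} (h : [a, b, d] <:+: l₁ ++ c :: l₂) :
    [a, b, d] <:+: l₁ ++ [c] ∨ [a, b, d] <:+: c :: l₂ ∨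
      (b = c ∧ (∃ p, l₁ = p ++ [a]) ∧ ∃ q, l₂ = d :: q) := by
  induction l₁ with
  | nil => exact Or.inr (Or.inl h)
  | cons e l₁ ih =>
    rw [List.cons_append, List.infix_cons_iff] at h
    rcases h with h | h
    · obtain ⟨t, ht⟩ := h
      match l₁ with
      | [] =>
        simp only [List.cons_append, List.nil_append, List.cons.injEq] at ht
        exact Or.inr (Or.inr ⟨ht.2.1, ⟨[], by simp [ht.1]⟩, t, ht.2.2.symm⟩)
      | [f] =>
        simp only [List.cons_append, List.nil_append, List.cons.injEq] at ht
        refine Or.inl ⟨[], [], ?_⟩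
        simp [ht]
      | f :: g :: l₁ =>
        simp only [List.cons_append, List.nil_append, List.cons.injEq] at ht
        refine Or.inl ⟨[], l₁ ++ [c], ?_⟩
        simp [ht]
    · rcases ih h with h | h | ⟨h, ⟨p, hp⟩, hq⟩
      · exact Or.inl (h.trans (List.suffix_cons _ _).isInfix)
      · exact Or.inr (Or.inl h)
      · exact Or.inr (Or.inr ⟨h, ⟨e :: p, by simp [hp]⟩, hq⟩)

theorem IsPath.adj_of_triple_infix {a b c : V} (h : IsPath G l x y) (habc : [a, b, c] <:+: l) :
    (G.Adj a b ∨ G.Adj b a) ∧ (G.Adj b c ∨ G.Adj c b) := by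
  have := h.2.1.infix habc
  simpa using this

/-- Adding a sink to the conditioning set does not block any path: an inner node of a path which is
a sink is a collider. -/
theorem IsActive.insert_sink (hj : ∀ v, ¬ G.Adj j v) (hl : IsPath G l x y)
    (h : IsActive G Z l) : IsActive G (insert j Z) l := by
  intro a b c habc
  have := h a b c habc
  refine ⟨fun hc => ?_, fun hc hb => ?_⟩
  · obtain ⟨z, hz, hbz⟩ := this.1 hc
    exact ⟨z, Or.inr hz, hbz⟩
  · rcases hb with rfl | hb
    · have := hl.adj_of_triple_infix habc
      exact hc ⟨this.1.resolve_right (hj _), this.2.resolve_left (hj _)⟩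
    · exact this.2 hc hb

theorem DSep.of_insert_sink (hj : ∀ v, ¬ G.Adj j v) (h : DSep G X Y (insert j Z)) :
    DSep G X Y Z :=
  fun x hx y hy _ hl ha => h x hx y hy _ hl (ha.insert_sink hj hl)

section Remove

variable (hG₀ : ∀ a b, G₀.Adj a b ↔ G.Adj a b ∧ b ≠ j) (hj : ∀ v, ¬ G.Adj j v)

include hG₀ in
theorem IsPath.of_remove_sink (h : IsPath G₀ l x y) : IsPath G l x y :=
  ⟨h.1, h.2.1.imp fun a b hab => hab.imp (fun h => ((hG₀ a b).1 h).1)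
    (fun h => ((hG₀ b a).1 h).1), h.2.2⟩

include hG₀ hj in
theorem IsActive.of_remove_sink (hl : IsPath G₀ l x y) (h : IsActive G₀ Z l) :
    IsActive G Z l := by
  intro a b c habc
  have h1 := h a b c habc
  have h2 := hl.adj_of_triple_infix habc
  have hb : b ≠ j := by
    rintro rfl
    rcases h2.1 with h | h
    · exact ((hG₀ _ _).1 h).2 rfl
    · exact hj _ ((hG₀ _ _).1 h).1
  have hiff : IsCollider G₀ a b c ↔ IsCollider G a b c := by
    simp [IsCollider, hG₀, hb]
  rw [hiff] at h1
  refine ⟨fun hc => ?_, h1.2⟩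
  obtain ⟨z, hz, hbz⟩ := h1.1 hc
  exact ⟨z, hz, Relation.ReflTransGen.mono (fun a b hab => ((hG₀ a b).1 hab).1) _ _ hbz⟩

include hG₀ hj in
theorem DSep.remove_sink (h : DSep G X Y Z) : DSep G₀ X Y Z :=
  fun x hx y hy l hl ha =>
    h x hx y hy l (hl.of_remove_sink hG₀) (ha.of_remove_sink hG₀ hj hl)

include hG₀ hj in
/-- A set that is d-separated from the sink `j` is, after removal of `j`, d-separated from those
parents of `j` that are not conditioned on: a path to such a parent could be prolonged to `j`. -/
theorem DSep.parents_of_sink (hY : j ∉ Y) (h : DSep G Y {j} Z) :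
    DSep G₀ Y ({p | G.Adj p j} \ Z) Z := by
  rintro y hy p ⟨hpj, hpZ⟩ l hl ha
  have hjl : j ∉ l := by
    intro hjl
    obtain ⟨l₁, l₂, rfl⟩ := List.append_of_mem hjl
    have hpj' : p ≠ j := fun e => hj j (by rw [← e] at hpj ⊢; exact hpj)
    have hyj : y ≠ j := fun e => hY (e ▸ hy)
    obtain ⟨-, hc, hh, -⟩ := hl
    match l₁, hh with
    | [], hh => exact hyj (by simpa using hh.symm)
    | e :: l₁, hh =>
      have h3 := (List.isChain_append.1 hc).2.2
      have h4 := h3 _ (List.getLast?_eq_getLast_of_ne_nil (by simp)) j (by simp)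
      rcases h4 with h4 | h4
      · exact ((hG₀ _ _).1 h4).2 rfl
      · exact hj _ ((hG₀ _ _).1 h4).1
  have hlG := hl.of_remove_sink hG₀
  have haG := ha.of_remove_sink hG₀ hj hl
  refine h y hy j rfl (l ++ [j]) ⟨?_, ?_, ?_, ?_⟩ ?_
  · simp [List.nodup_append, hl.1]
    exact fun a ha e => hjl (e ▸ ha)
  · refine List.isChain_append.2 ⟨hlG.2.1, by simp, ?_⟩
    intro a ha b hb
    rw [hl.2.2.2] at ha
    simp at ha hb
    subst ha hb
    exact Or.inl hpj
  · simp [List.head?_append, hl.2.2.1]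
  · simp
  · obtain ⟨l', hl'⟩ : ∃ l', l = l' ++ [p] := by
      have := hl.2.2.2
      rw [List.getLast?_eq_some_iff] at this
      exact this
    subst hl'
    intro a b d habd
    rw [List.append_assoc, List.singleton_append] at habd
    rcases triple_infix_append habd with h | h | ⟨rfl, -, q, hq⟩
    · exact haG a b d h
    · have := h.length_le
      simp at this
    · simp only [List.cons.injEq] at hq
      obtain ⟨rfl, -⟩ := hq
      exact ⟨fun hc => (hj _ hc.2).elim, fun _ => hpZ⟩

end Remove

/-- A node entered along an active path that ends in a sink `j` has a descendant which is `j` or is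
conditioned on: follow the path until it meets a collider or ends. -/
theorem exists_descendant_of_isActive {a c : V} {r : List V}
    (hact : IsActive G Z (a :: c :: r))
    (hch : (c :: r).IsChain (fun x y => G.Adj x y ∨ G.Adj y x))
    (hlast : (c :: r).getLast? = some j) (hac : G.Adj a c) :
    ∃ z ∈ insert j Z, Relation.ReflTransGen G.Adj c z := by
  induction r generalizing a c with
  | nil =>
    simp at hlast
    exact ⟨j, Or.inl rfl, hlast ▸ Relation.ReflTransGen.refl⟩
  | cons e r ih =>
    by_cases hec : G.Adj e c
    · obtain ⟨z, hz, hcz⟩ := (hact a c e ⟨[], r, rfl⟩).1 ⟨hac, hec⟩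
      exact ⟨z, Or.inr hz, hcz⟩
    · rw [List.isChain_cons_cons] at hch
      have hce := hch.1.resolve_right hec
      obtain ⟨z, hz, hez⟩ := ih (hact.of_infix (List.suffix_cons _ _).isInfix) hch.2
        (by simpa using hlast) hce
      exact ⟨z, hz, Relation.ReflTransGen.head hce hez⟩

/-- Two paths that are active given `Z` and end in the same sink `j` can be joined at the first
node of one that lies on the other, and the result is active given `Z` and `j`. -/
theorem exists_isActive_join {l l' : List V} (hj : ∀ v, ¬ G.Adj j v)
    (hl : IsPath G l x j) (hl' : IsPath G l' y j) (ha : IsActive G Z l) (ha' : IsActive G Z l') :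
    ∃ k, IsPath G k x y ∧ IsActive G (insert j Z) k := by
  have hjl : j ∈ l := List.mem_of_getLast? hl.2.2.2
  have hjl' : j ∈ l' := List.mem_of_getLast? hl'.2.2.2
  -- `c` is the first node of `l` that lies on `l'`
  obtain ⟨l₁, c, l₂, rfl, hc, hdisj⟩ :
      ∃ l₁ c l₂, l = l₁ ++ c :: l₂ ∧ c ∈ l' ∧ ∀ b ∈ l₁, b ∉ l' := by
    clear hl ha
    induction l with
    | nil => simp at hjl
    | cons e l ih =>
      by_cases he : e ∈ l'
      · exact ⟨[], e, l, rfl, he, by simp⟩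
      · have : j ∈ l := by
          rcases List.mem_cons.1 hjl with h | h
          · exact (he (h ▸ hjl')).elim
          · exact h
        obtain ⟨l₁, c, l₂, rfl, hc, h⟩ := ih this
        exact ⟨e :: l₁, c, l₂, rfl, hc, by simpa [he] using h⟩
  obtain ⟨r₁, r₂, rfl⟩ := List.append_of_mem hc
  have hnd := hl.1
  have hnd' := hl'.1
  have hch := List.isChain_append.1 hl.2.1
  have hch' := List.isChain_append.1 hl'.2.1
  have hlast : (c :: l₂).getLast? = some j := by
    have := hl.2.2.2
    rwa [List.getLast?_append_of_ne_nil _ (by simp)] at this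
  have hlast' : (c :: r₂).getLast? = some j := by
    have := hl'.2.2.2
    rwa [List.getLast?_append_of_ne_nil _ (by simp)] at this
  have hk' : IsPath G (r₁ ++ [c]) y c := by
    refine ⟨?_, ?_, ?_, by simp⟩
    · exact hnd'.sublist (by simp)
    · exact hl'.2.1.infix ⟨[], r₂, by simp⟩
    · have := hl'.2.2.1
      cases r₁ <;> simpa using this
  refine ⟨l₁ ++ c :: r₁.reverse, ⟨?_, ?_, ?_, ?_⟩, ?_⟩
  · rw [List.nodup_append] at hnd hnd' ⊢
    refine ⟨hnd.1, ?_, ?_⟩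
    · rw [List.nodup_cons, List.nodup_reverse, List.mem_reverse]
      exact ⟨fun h => hnd'.2.2 c h c (by simp) rfl, hnd'.1⟩
    · rintro a ha b hb rfl
      apply hdisj a ha
      simp at hb ⊢
      tauto
  · refine List.isChain_append.2 ⟨hch.1, ?_, ?_⟩
    · have := hk'.reverse.2.1
      simpa using this
    · intro a ha b hb
      simp at hb
      exact hch.2.2 a ha b (by simp [hb])
  · have := hl.2.2.1
    cases l₁ <;> simpa using this
  · have := hk'.reverse.2.2.2
    simpa using this
  · have hpath : IsPath G (l₁ ++ [c]) x c := by
      refine ⟨hnd.sublist (by simp), hl.2.1.infix ⟨[], l₂, by simp⟩, ?_, by simp⟩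
      have := hl.2.2.1
      cases l₁ <;> simpa using this
    intro a b d habd
    rcases triple_infix_append habd with h | h | ⟨rfl, ⟨p, rfl⟩, q, hq⟩
    · exact (ha.of_infix ⟨[], l₂, by simp⟩).insert_sink hj hpath a b d h
    · have h2 : IsActive G (insert j Z) (r₁ ++ [c]).reverse :=
        ((ha'.of_infix ⟨[], r₂, by simp⟩).insert_sink hj hk').reverse
      exact h2 a b d (by simpa using h)
    · obtain ⟨p', rfl⟩ : ∃ p', r₁ = p' ++ [d] := by
        refine ⟨q.reverse, ?_⟩
        rw [← List.reverse_reverse r₁, hq]; simp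
      have hA : IsActive G Z (a :: b :: l₂) := ha.of_infix ⟨p, [], by simp⟩
      have hD : IsActive G Z (d :: b :: r₂) := ha'.of_infix ⟨p', [], by simp⟩
      have hab : G.Adj a b ∨ G.Adj b a := hch.2.2 a (by simp) b (by simp)
      have hdb : G.Adj d b ∨ G.Adj b d := hch'.2.2 d (by simp) b (by simp)
      refine ⟨fun hcol => exists_descendant_of_isActive hA hch.2.1 hlast hcol.1, fun hcol => ?_⟩
      have hbj : b ≠ j := by
        rintro rfl
        exact hcol ⟨hab.resolve_right (hj _), hdb.resolve_right (hj _)⟩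
      rintro (h | hbZ)
      · exact hbj h
      obtain ⟨e, l₂', rfl⟩ : ∃ e l₂', l₂ = e :: l₂' := by
        cases l₂ with
        | nil => simp at hlast; exact (hbj hlast).elim
        | cons e l => exact ⟨e, l, rfl⟩
      obtain ⟨f, r₂', rfl⟩ : ∃ f r₂', r₂ = f :: r₂' := by
        cases r₂ with
        | nil => simp at hlast'; exact (hbj hlast').elim
        | cons e l => exact ⟨e, l, rfl⟩
      -- not being a collider on the joined path, `b` is not a collider on one of the given paths
      by_cases h1 : G.Adj a b
      · exact (hD d b f ⟨[], r₂', rfl⟩).2 (fun h => hcol ⟨h1, h.1⟩) hbZ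
      · exact (hA a b e ⟨[], l₂', rfl⟩).2 (fun h => h1 h.1) hbZ

/-- If a sink `j` is conditioned on, one of the two separated sets is separated from `j` as well. -/
theorem DSep.or_sink (hj : ∀ v, ¬ G.Adj j v) (h : DSep G X Y (insert j Z)) :
    DSep G X {j} Z ∨ DSep G Y {j} Z := by
  by_contra! hcon
  simp only [DSep, not_forall, not_not, Set.mem_singleton_iff, exists_prop] at hcon
  obtain ⟨⟨x, hx, _, rfl, l, hl, ha⟩, y, hy, _, rfl, l', hl', ha'⟩ := hcon
  obtain ⟨k, hk, hka⟩ := exists_isActive_join hj hl hl' ha ha'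
  exact h x hx y hy k hk hka

end Graph

/-! ### Vanishing of the structural distances between equal graphs -/

theorem SHD_self {V : Type*} (G : Digraph V) : SHD G G = 0 := by
  simp [SHD]

section FiniteLaws

open scoped Classical

variable {V : Type*} [Fintype V] {m : V → ℕ} {p : (∀ v, Fin (m v)) → ℝ}

theorem prob_pos (hp : ∀ x, 0 < p x) {A : Set (∀ v, Fin (m v))} (hA : A.Nonempty) :
    0 < prob p A := by
  obtain ⟨x, hx⟩ := hA
  exact Finset.sum_pos (fun y _ => hp y) ⟨x, by simpa using hx⟩

/-- The truncated factorization divides the joint law by `p(x_i | x_{PA_i})`. -/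
theorem doProb_eq {G : Digraph V} (hp : IsPositiveMarkovPMF p G) (i j : V)
    (a : Fin (m i)) (b : Fin (m j)) :
    doProb p G i j a b = ∑ y ∈ Finset.univ.filter (fun y : ∀ v, Fin (m v) => y i = a ∧ y j = b),
      p y / condParents p G i y := by
  refine Finset.sum_congr rfl fun y _ => ?_
  have hpos : 0 < condParents p G i y :=
    div_pos (prob_pos hp.1 ⟨y, rfl, fun _ _ => rfl⟩) (prob_pos hp.1 ⟨y, fun _ _ => rfl⟩)
  rw [eq_div_iff hpos.ne', hp.2.2 y, ← Finset.prod_filter_mul_prod_filter_not Finset.univ (· ≠ i)]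
  congr 1
  · simp only [not_not]
    rw [Finset.prod_filter, Finset.prod_ite_eq' Finset.univ i, if_pos (Finset.mem_univ i)]

/-- Adjusting for the true parents is correct. -/
theorem adjustProb_eq_doProb {G : Digraph V} (hG : ∀ v, ¬ G.Adj v v)
    (hp : IsPositiveMarkovPMF p G) {i j : V}
    (a : Fin (m i)) (b : Fin (m j)) : adjustProb p G i j a b = doProb p G i j a b := by
  have key : doProb p G i j a b = ∑ z : ∀ v : {v : V // G.Adj v i}, Fin (m v),
      prob p {y | y j = b ∧ y i = a ∧ ∀ v, y v.1 = z v} /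
      prob p {y | y i = a ∧ ∀ v, y v.1 = z v} * prob p {y | ∀ v, y v.1 = z v} := by
    rw [doProb_eq hp]
    rw [← Finset.sum_fiberwise (g := fun (y : ∀ v, Fin (m v)) (v : {v : V // G.Adj v i}) => y v.1)]
    refine Finset.sum_congr rfl fun z _ => ?_
    rw [prob, Finset.sum_div, Finset.sum_mul]
    rw [Finset.filter_filter]
    refine Finset.sum_congr ?_ fun y hy => ?_
    · ext y
      simp only [Finset.mem_filter, Finset.mem_univ, true_and, Set.mem_ofPred_eq, funext_iff]
      tauto
    · simp only [Finset.mem_filter, Finset.mem_univ, true_and, Set.mem_ofPred_eq] at hy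
      have h1 : parentsEvent G i y = {y | ∀ v : {v : V // G.Adj v i}, y v.1 = z v} := by
        ext y'
        simp only [parentsEvent, Set.mem_ofPred_eq, Subtype.forall]
        exact forall₂_congr fun v hv => by rw [hy.2.2 ⟨v, hv⟩]
      have h2 : {y' : ∀ v, Fin (m v) | y' i = y i} ∩ parentsEvent G i y =
          {y | y i = a ∧ ∀ v : {v : V // G.Adj v i}, y v.1 = z v} := by
        rw [h1, hy.2.1]; rfl
      rw [condParents, h2, h1, div_div_eq_mul_div, div_mul_eq_mul_div]
  rw [key, adjustProb]
  split_ifs with hji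
  -- if `j` is a parent of `i`, only the `z` with `z j = b` contribute, with quotient `1`
  · have hsum : prob p {y | y j = b} = ∑ z : ∀ v : {v : V // G.Adj v i}, Fin (m v),
        if z ⟨j, hji⟩ = b then prob p {y | ∀ v, y v.1 = z v} else 0 := by
      rw [prob, ← Finset.sum_fiberwise
        (g := fun (y : ∀ v, Fin (m v)) (v : {v : V // G.Adj v i}) => y v.1)]
      refine Finset.sum_congr rfl fun z _ => ?_
      rw [Finset.filter_filter]
      split_ifs with hz
      · refine Finset.sum_congr ?_ fun _ _ => rfl
        ext y
        simp only [Finset.mem_filter, Finset.mem_univ, true_and, Set.mem_ofPred_eq, funext_iff]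
        refine ⟨fun h => h.2, fun h => ⟨?_, h⟩⟩
        rw [← hz]; exact h ⟨j, hji⟩
      · refine Finset.sum_eq_zero fun y hy => ?_
        simp only [Finset.mem_filter, Finset.mem_univ, true_and, Set.mem_ofPred_eq] at hy
        exact (hz (by rw [← hy.2]; exact hy.1)).elim
    rw [hsum]
    refine Finset.sum_congr rfl fun z _ => ?_
    obtain ⟨y₀, -⟩ : (Finset.univ : Finset (∀ v, Fin (m v))).Nonempty :=
      Finset.nonempty_of_sum_ne_zero (hp.2.1.trans_ne one_ne_zero)
    split_ifs with hz
    · have hset : {y : ∀ v, Fin (m v) | y j = b ∧ y i = a ∧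
          ∀ v : {v : V // G.Adj v i}, y v.1 = z v} =
          {y | y i = a ∧ ∀ v : {v : V // G.Adj v i}, y v.1 = z v} := by
        ext y
        refine ⟨fun h => h.2, fun h => ⟨?_, h⟩⟩
        rw [← hz]; exact h.2 ⟨j, hji⟩
      have hpos : 0 < prob p {y | y i = a ∧ ∀ v : {v : V // G.Adj v i}, y v.1 = z v} := by
        refine prob_pos hp.1 ⟨fun v => if h : G.Adj v i then z ⟨v, h⟩ else
          if h : v = i then h ▸ a else y₀ v, ?_, fun v => ?_⟩
        · simp [hG i]
        · simp [v.2]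
      rw [hset, div_self hpos.ne', one_mul]
    · have hset : {y : ∀ v, Fin (m v) | y j = b ∧ y i = a ∧
          ∀ v : {v : V // G.Adj v i}, y v.1 = z v} = ∅ := by
        ext y
        simp only [Set.mem_ofPred_eq, Set.mem_empty_iff_false, iff_false]
        rintro ⟨h1, -, h3⟩
        exact hz (by rw [← h1]; exact (h3 ⟨j, hji⟩).symm)
      rw [hset]; simp [prob]
  · rfl

theorem SID_self {G : Digraph V} (hG : ∀ v, ¬ G.Adj v v) : SID G G = 0 := by
  have : {e : V × V | e.1 ≠ e.2 ∧
    ∃ (m : V → ℕ) (p : (∀ v, Fin (m v)) → ℝ), IsPositiveMarkovPMF p G ∧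
      ∃ (a : Fin (m e.1)) (b : Fin (m e.2)),
        adjustProb p G e.1 e.2 a b ≠ doProb p G e.1 e.2 a b} = ∅ := by
    ext e
    simp only [Set.mem_ofPred_eq, Set.mem_empty_iff_false, iff_false]
    rintro ⟨-, m, p, hp, a, b, h⟩
    exact h (adjustProb_eq_doProb hG hp a b)
  rw [SID, this, Set.ncard_empty]

end FiniteLaws

/-! ### Conditional independence of σ-algebras -/

section CondIndep

open ProbabilityTheory

variable {Ω : Type*} {m' m₁ m₂ mΩ : MeasurableSpace Ω} {μ : Measure Ω} [IsFiniteMeasure μ]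

theorem isPiSystem_image2_inter (m₁ m₂ : MeasurableSpace Ω) :
    IsPiSystem (Set.image2 (· ∩ ·) {s | MeasurableSet[m₁] s} {s | MeasurableSet[m₂] s}) := by
  rintro _ ⟨a, ha, b, hb, rfl⟩ _ ⟨c, hc, d, hd, rfl⟩ -
  exact ⟨a ∩ c, MeasurableSet.inter ha hc, b ∩ d, MeasurableSet.inter hb hd,
    Set.inter_inter_inter_comm _ _ _ _⟩

theorem sup_eq_generateFrom_image2_inter (m₁ m₂ : MeasurableSpace Ω) :
    m₁ ⊔ m₂ = MeasurableSpace.generateFrom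
      (Set.image2 (· ∩ ·) {s | MeasurableSet[m₁] s} {s | MeasurableSet[m₂] s}) := by
  refine le_antisymm (sup_le ?_ ?_) (MeasurableSpace.generateFrom_le ?_)
  · exact fun s hs => MeasurableSpace.measurableSet_generateFrom
      ⟨s, hs, Set.univ, MeasurableSet.univ, Set.inter_univ s⟩
  · exact fun s hs => MeasurableSpace.measurableSet_generateFrom
      ⟨Set.univ, MeasurableSet.univ, s, hs, Set.univ_inter s⟩
  · rintro _ ⟨a, ha, b, hb, rfl⟩
    exact MeasurableSet.inter ((le_sup_left : m₁ ≤ m₁ ⊔ m₂) _ ha)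
      ((le_sup_right : m₂ ≤ m₁ ⊔ m₂) _ hb)

theorem integrable_indicator_one {t : Set Ω} (ht : MeasurableSet t) :
    Integrable (t.indicator fun _ => (1 : ℝ)) μ :=
  (integrable_const 1).indicator ht

/-- Conditional independence says that further conditioning on the second σ-algebra does not change
the conditional probabilities of the events of the first one. -/
theorem condIndep_iff_condExp_sup [StandardBorelSpace Ω] (hm' : m' ≤ mΩ) (hm₁ : m₁ ≤ mΩ)
    (hm₂ : m₂ ≤ mΩ) :
    CondIndep m' m₁ m₂ hm' μ ↔
      ∀ t, MeasurableSet[m₁] t → μ⟦t | m' ⊔ m₂⟧ =ᵐ[μ] μ⟦t | m'⟧ := by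
  have hsup : m' ⊔ m₂ ≤ mΩ := sup_le hm' hm₂
  rw [condIndep_iff m' m₁ m₂ hm' hm₁ hm₂]
  constructor
  · intro h t ht
    have hti := integrable_indicator_one (μ := μ) (hm₁ t ht)
    have hgi : Integrable (μ⟦t | m'⟧) μ := integrable_condExp
    have hsm : StronglyMeasurable[m' ⊔ m₂] (μ⟦t | m'⟧) :=
      stronglyMeasurable_condExp.mono le_sup_left
    refine (ae_eq_condExp_of_forall_setIntegral_eq hsup hti (fun _ _ _ => hgi.integrableOn)
      (fun s hs _ => ?_) hsm.aestronglyMeasurable).symm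
    have basic : ∀ a b, MeasurableSet[m'] a → MeasurableSet[m₂] b →
        ∫ x in a ∩ b, (μ⟦t | m'⟧) x ∂μ = ∫ x in a ∩ b, t.indicator (fun _ => (1 : ℝ)) x ∂μ := by
      intro a b ha hb
      have hbi := integrable_indicator_one (μ := μ) (hm₂ b hb)
      have hmul : ∀ f : Ω → ℝ, b.indicator f = f * b.indicator fun _ => (1 : ℝ) := by
        intro f; ext x; by_cases hx : x ∈ b <;> simp [hx]
      have hfg : Integrable ((μ⟦t | m'⟧) * b.indicator fun _ => (1 : ℝ)) μ := by
        rw [← hmul]; exact hgi.indicator (hm₂ b hb)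
      rw [← setIntegral_indicator (hm₂ b hb), ← setIntegral_indicator (hm₂ b hb)]
      rw [← setIntegral_condExp hm' (hgi.indicator (hm₂ b hb)) ha,
        ← setIntegral_condExp hm' (hti.indicator (hm₂ b hb)) ha]
      refine setIntegral_congr_ae (hm' a ha) ?_
      have h1 := h t b ht hb
      have h2 := condExp_mul_of_stronglyMeasurable_left
        (stronglyMeasurable_condExp (μ := μ) (f := t.indicator fun _ => (1 : ℝ)) (m := m')) hfg hbi
      rw [← hmul] at h2
      have h3 : b.indicator (t.indicator fun _ => (1 : ℝ)) =
          (t ∩ b).indicator fun _ => (1 : ℝ) := by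
        rw [Set.indicator_indicator, Set.inter_comm]
      rw [h3]
      filter_upwards [h1, h2] with x hx1 hx2 _
      rw [hx1, hx2]
    have huniv := basic Set.univ Set.univ MeasurableSet.univ MeasurableSet.univ
    simp only [Set.inter_univ, setIntegral_univ] at huniv
    refine MeasurableSpace.induction_on_inter (m := m' ⊔ m₂)
      (C := fun s _ => ∫ x in s, (μ⟦t | m'⟧) x ∂μ = ∫ x in s, t.indicator (fun _ => (1 : ℝ)) x ∂μ)
      (sup_eq_generateFrom_image2_inter m' m₂) (isPiSystem_image2_inter m' m₂) (by simp)
      ?_ ?_ ?_ s hs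
    · rintro _ ⟨a, ha, b, hb, rfl⟩
      exact basic a b ha hb
    · intro s hs heq
      have h1 := integral_add_compl (hsup s hs) hgi
      have h2 := integral_add_compl (hsup s hs) hti
      linarith
    · intro f hf hfm heq
      rw [integral_iUnion (fun i => hsup _ (hfm i)) hf hgi.integrableOn,
        integral_iUnion (fun i => hsup _ (hfm i)) hf hti.integrableOn]
      exact tsum_congr heq
  · intro h t₁ t₂ ht₁ ht₂
    have hi₁ := integrable_indicator_one (μ := μ) (hm₁ t₁ ht₁)
    have hi₂ := integrable_indicator_one (μ := μ) (hm₂ t₂ ht₂)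
    have hgi : Integrable (μ⟦t₁ | m'⟧) μ := integrable_condExp
    have hmul : ∀ f : Ω → ℝ, t₂.indicator f = f * t₂.indicator fun _ => (1 : ℝ) := by
      intro f; ext x; by_cases hx : x ∈ t₂ <;> simp [hx]
    have h0 : (t₁ ∩ t₂).indicator (fun _ => (1 : ℝ)) = t₂.indicator (t₁.indicator fun _ => 1) := by
      rw [Set.indicator_indicator, Set.inter_comm]
    have h1 : μ[t₂.indicator (t₁.indicator fun _ => (1 : ℝ)) | m' ⊔ m₂] =ᵐ[μ]
        t₂.indicator (μ⟦t₁ | m' ⊔ m₂⟧) :=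
      condExp_indicator hi₁ ((le_sup_right : m₂ ≤ m' ⊔ m₂) _ ht₂)
    have h2 : t₂.indicator (μ⟦t₁ | m' ⊔ m₂⟧) =ᵐ[μ] t₂.indicator (μ⟦t₁ | m'⟧) := by
      filter_upwards [h t₁ ht₁] with x hx
      by_cases hx2 : x ∈ t₂ <;> simp [hx2, hx]
    have h3 : μ[t₂.indicator (μ⟦t₁ | m'⟧) | m'] =ᵐ[μ] (μ⟦t₁ | m'⟧) * (μ⟦t₂ | m'⟧) := by
      have hfg : Integrable ((μ⟦t₁ | m'⟧) * t₂.indicator fun _ => (1 : ℝ)) μ := by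
        rw [← hmul]; exact hgi.indicator (hm₂ t₂ ht₂)
      rw [hmul]
      exact condExp_mul_of_stronglyMeasurable_left stronglyMeasurable_condExp hfg hi₂
    rw [h0]
    exact (condExp_condExp_of_le le_sup_left hsup).symm.trans
      ((condExp_congr_ae (h1.trans h2)).trans h3)

end CondIndep

/-! ### Conditional independence of sets of variables -/

section SemiGraphoid

open ProbabilityTheory

variable {V : Type*} {Ω : V → Type u} [∀ v, MeasurableSpace (Ω v)]

theorem coordSigma_union (S T : Set V) :
    coordSigma Ω (S ∪ T) = coordSigma Ω S ⊔ coordSigma Ω T :=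
  iSup_union

theorem coordSigma_mono {S T : Set V} (h : S ⊆ T) : coordSigma Ω S ≤ coordSigma Ω T :=
  biSup_mono h

variable [Fintype V] [∀ v, StandardBorelSpace (Ω v)] {P : Measure (∀ v, Ω v)} [IsFiniteMeasure P]

/-- The variables in `X` are conditionally independent of those in `Y` given those in `Z`. -/
def CI (P : Measure (∀ v, Ω v)) [IsFiniteMeasure P] (Z X Y : Set V) : Prop :=
  CondIndep (coordSigma Ω Z) (coordSigma Ω X) (coordSigma Ω Y) (coordSigma_le Ω Z) P

variable {X X' Y Y' Z W : Set V}

theorem ci_iff : CI P Z X Y ↔ ∀ t, MeasurableSet[coordSigma Ω X] t →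
    P⟦t | coordSigma Ω (Z ∪ Y)⟧ =ᵐ[P] P⟦t | coordSigma Ω Z⟧ := by
  rw [coordSigma_union]
  exact condIndep_iff_condExp_sup (coordSigma_le Ω Z) (coordSigma_le Ω X) (coordSigma_le Ω Y)

theorem CI.symm (h : CI P Z X Y) : CI P Z Y X := CondIndep.symm h

theorem CI.mono_right (h : CI P Z X Y) (hY : Y' ⊆ Y) : CI P Z X Y' :=
  condIndep_of_condIndep_of_le_right h (coordSigma_mono hY)

theorem CI.weak_union (h : CI P Z X Y) (hW : W ⊆ Y) : CI P (Z ∪ W) X Y := by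
  rw [ci_iff] at *
  intro t ht
  have h1 := ci_iff.1 ((ci_iff.2 h).mono_right hW) t ht
  have h2 := h t ht
  have : Z ∪ W ∪ Y = Z ∪ Y := by rw [Set.union_assoc, Set.union_eq_self_of_subset_left hW]
  rw [this]
  exact h2.trans h1.symm

theorem CI.contraction (h : CI P Z X Y) (h' : CI P (Z ∪ Y) X W) : CI P Z X (Y ∪ W) := by
  rw [ci_iff] at *
  intro t ht
  rw [← Set.union_assoc]
  exact (h' t ht).trans (h t ht)

theorem ci_empty_left : CI P Z ∅ Y := by
  have : coordSigma Ω (∅ : Set V) = ⊥ := by simp [coordSigma]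
  rw [CI, this]
  exact condIndep_bot_left _

end SemiGraphoid

/-! ### The global Markov property from the local one -/

section Markov

variable {V : Type*}

/-- `T` contains all parents of its elements. -/
def IsAncestral (G : Digraph V) (T : Set V) : Prop := ∀ a b, G.Adj a b → b ∈ T → a ∈ T

/-- The subgraph of `G` that keeps only the edges between nodes of `W`. -/
def restrictTo (G : Digraph V) (W : Set V) : Digraph V :=
  ⟨fun a b => G.Adj a b ∧ a ∈ W ∧ b ∈ W⟩

theorem restrictTo_diff_sink_adj {G : Digraph V} {W : Set V} {j : V}
    (hj : ∀ v ∈ W, ¬ G.Adj j v) (a b : V) :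
    (restrictTo G (W \ {j})).Adj a b ↔ (restrictTo G W).Adj a b ∧ b ≠ j := by
  simp only [restrictTo, Set.mem_sdiff, Set.mem_singleton_iff]
  refine ⟨fun h => ⟨⟨h.1, h.2.1.1, h.2.2.1⟩, h.2.2.2⟩,
    fun h => ⟨h.1.1, ⟨h.1.2.1, ?_⟩, h.1.2.2, h.2⟩⟩
  rintro rfl
  exact hj b h.1.2.2 h.1.1

theorem exists_sink [Finite V] {G : Digraph V} (hG : ∀ v, ¬ Relation.TransGen G.Adj v v)
    {W : Set V} (hW : W.Nonempty) : ∃ j ∈ W, ∀ v ∈ W, ¬ G.Adj j v := by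
  have : IsTrans V (Function.swap (Relation.TransGen G.Adj)) :=
    ⟨fun _ _ _ h h' => Relation.TransGen.trans h' h⟩
  have : Std.Irrefl (Function.swap (Relation.TransGen G.Adj)) := ⟨hG⟩
  obtain ⟨j, hj, h⟩ := (Finite.wellFounded_of_trans_of_irrefl
    (Function.swap (Relation.TransGen G.Adj))).has_min W hW
  exact ⟨j, hj, fun v hv hjv => h v hv (Relation.TransGen.single hjv)⟩

theorem IsAncestral.diff_sink {G : Digraph V} {W : Set V} {j : V} (hW : IsAncestral G W)
    (hj : ∀ v ∈ W, ¬ G.Adj j v) : IsAncestral G (W \ {j}) := by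
  rintro a b hab ⟨hb, -⟩
  refine ⟨hW a b hab hb, ?_⟩
  rintro rfl
  exact hj b hb hab

variable [Fintype V] {Ω : V → Type u} [∀ v, MeasurableSpace (Ω v)]
  [∀ v, StandardBorelSpace (Ω v)] {P : Measure (∀ v, Ω v)} [IsFiniteMeasure P]

/-- The case of the global Markov property in which a sink `j` belongs to a separated set: the other
set is separated from the parents of `j`, which screen `j` off. -/
theorem ci_of_dSep_of_sink_mem {G : Digraph V} {W : Set V} (hWG : IsAncestral G W) {j : V}
    (hjW : j ∈ W) (hj : ∀ v ∈ W, ¬ G.Adj j v) (hloc : CI P {p | G.Adj p j} {j} (W \ {j}))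
    (ih : ∀ X Y Z : Set V, X ⊆ W \ {j} → Y ⊆ W \ {j} → Z ⊆ W \ {j} → Disjoint X Z → Disjoint Y Z →
      DSep (restrictTo G (W \ {j})) X Y Z → CI P Z X Y)
    {X Y Z : Set V} (hX : X ⊆ W) (hY : Y ⊆ W) (hZ : Z ⊆ W) (hXZ : Disjoint X Z)
    (hYZ : Disjoint Y Z) (hd : DSep (restrictTo G W) X Y Z) (hjX : j ∈ X) : CI P Z X Y := by
  have hjY : j ∉ Y := Set.disjoint_left.1 hd.disjoint hjX
  have hjZ : j ∉ Z := Set.disjoint_left.1 hXZ hjX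
  have hG₀ := restrictTo_diff_sink_adj hj
  have hj' : ∀ v, ¬ (restrictTo G W).Adj j v := fun v h => hj v h.2.2 h.1
  have hpa : {p | (restrictTo G W).Adj p j} = {p | G.Adj p j} := by
    ext p
    exact ⟨fun h => h.1, fun h => ⟨h, hWG p j h hjW, hjW⟩⟩
  have hpaW : {p | G.Adj p j} ⊆ W \ {j} := fun p hp =>
    ⟨hWG p j hp hjW, fun e => hj j hjW (by rw [Set.mem_singleton_iff] at e; rwa [e] at hp)⟩
  have hd₁ : DSep (restrictTo G (W \ {j})) Y (X \ {j}) Z :=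
    fun y hy x hx => (hd.remove_sink hG₀ hj').symm y hy x hx.1
  have hd₂ : DSep (restrictTo G (W \ {j})) Y ({p | G.Adj p j} \ Z) Z := by
    rw [← hpa]
    refine DSep.parents_of_sink hG₀ hj' hjY fun y hy x hx => hd.symm y hy x ?_
    rw [Set.mem_singleton_iff.1 hx]; exact hjX
  have hsub : ∀ {S : Set V}, S ⊆ W → j ∉ S → S ⊆ W \ {j} := fun hS hjS s hs =>
    ⟨hS hs, fun e => hjS (Set.mem_singleton_iff.1 e ▸ hs)⟩
  have hX₀ : X \ {j} ⊆ W \ {j} := Set.sdiff_subset_sdiff_left hX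
  have hci := ih Y (X \ {j} ∪ {p | G.Adj p j} \ Z) Z (hsub hY hjY)
    (Set.union_subset hX₀ (Set.sdiff_subset.trans hpaW)) (hsub hZ hjZ) hYZ
    (Set.disjoint_union_left.2 ⟨hXZ.mono_left Set.sdiff_subset, Set.disjoint_sdiff_left⟩)
    (hd₁.union_right hd₂)
  have hci' := ((hloc.weak_union (W := Z ∪ X \ {j})
    (Set.union_subset (hsub hZ hjZ) hX₀)).mono_right (hsub hY hjY)).symm
  have hset : {p | G.Adj p j} ∪ (Z ∪ X \ {j}) = Z ∪ (X \ {j} ∪ {p | G.Adj p j} \ Z) := by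
    ext v
    by_cases hv : v ∈ Z <;> simp [hv, or_comm]
  rw [hset] at hci'
  refine ((hci.contraction hci').mono_right fun x hx => ?_).symm
  by_cases hxj : x = j
  · exact Or.inr hxj
  · exact Or.inl (Or.inl ⟨hx, hxj⟩)

/-- The global Markov property holds as soon as each variable is independent, given its parents, of
the sets of variables that may precede it. It is enough to consider the sets which are ancestral in
some larger acyclic graph `H`, since the nodes can be removed in an order that is compatible with
`H`. -/
theorem globalMarkov_of_local {G H : Digraph V} (hGH : G ≤ H)
    (hH : ∀ v, ¬ Relation.TransGen H.Adj v v)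
    (hloc : ∀ (k : V) (T : Set V), IsAncestral H T → k ∉ T → {p | H.Adj p k} ⊆ T →
      CI P {p | G.Adj p k} {k} T) :
    GlobalMarkov G P := by
  suffices main : ∀ (n : ℕ) (W : Set V), W.ncard = n → IsAncestral H W → ∀ X Y Z : Set V,
      X ⊆ W → Y ⊆ W → Z ⊆ W → Disjoint X Z → Disjoint Y Z → DSep (restrictTo G W) X Y Z →
      CI P Z X Y by
    intro X Y Z _ hXZ hYZ hd
    refine main _ Set.univ rfl (fun _ _ _ _ => trivial) X Y Z (Set.subset_univ _)
      (Set.subset_univ _) (Set.subset_univ _) hXZ hYZ ?_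
    have : restrictTo G Set.univ = G := by
      ext a b; simp [restrictTo]
    rwa [this]
  intro n
  induction n with
  | zero =>
    intro W hn _ X Y Z hX _ _ _ _ _
    have hW : W = ∅ := (Set.ncard_eq_zero (Set.toFinite W)).1 hn
    rw [hW, Set.subset_empty_iff] at hX
    rw [hX]
    exact ci_empty_left
  | succ n ih =>
    intro W hn hWH
    obtain ⟨j, hjW, hjH⟩ := exists_sink hH (W := W) (by
      rw [← Set.ncard_pos (Set.toFinite W), hn]; omega)
    have hcard : (W \ {j}).ncard = n := by
      rw [Set.ncard_sdiff_singleton_of_mem hjW, hn]; rfl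
    have hW₀ := hWH.diff_sink hjH
    have hWG : IsAncestral G W := fun a b hab => hWH a b (hGH hab)
    have hj : ∀ v ∈ W, ¬ G.Adj j v := fun v hv hjv => hjH v hv (hGH hjv)
    specialize ih (W \ {j}) hcard hW₀
    have hpaW : {p | H.Adj p j} ⊆ W \ {j} := fun p hp =>
      ⟨hWH p j hp hjW, fun e => hjH j hjW (by rw [Set.mem_singleton_iff] at e; rwa [e] at hp)⟩
    have hl := hloc j _ hW₀ (by simp) hpaW
    have key : ∀ {X Y Z : Set V}, X ⊆ W → Y ⊆ W → Z ⊆ W → Disjoint X Z → Disjoint Y Z →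
        DSep (restrictTo G W) X Y Z → j ∈ X → CI P Z X Y :=
      ci_of_dSep_of_sink_mem hWG hjW hj hl ih
    have key' : ∀ {X Y Z : Set V}, X ⊆ W → Y ⊆ W → Z ⊆ W → Disjoint X Z → Disjoint Y Z →
        DSep (restrictTo G W) X Y Z → j ∈ Y → CI P Z X Y :=
      fun hX hY hZ hXZ hYZ hd hjY => (key hY hX hZ hYZ hXZ hd.symm hjY).symm
    have hj' : ∀ v, ¬ (restrictTo G W).Adj j v := fun v h => hj v h.2.2 h.1
    intro X Y Z hX hY hZ hXZ hYZ hd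
    by_cases hjX : j ∈ X
    · exact key hX hY hZ hXZ hYZ hd hjX
    by_cases hjY : j ∈ Y
    · exact key' hX hY hZ hXZ hYZ hd hjY
    by_cases hjZ : j ∈ Z
    · have hins : insert j (Z \ {j}) = Z := by
        rw [Set.insert_sdiff_singleton, Set.insert_eq_of_mem hjZ]
      have hd' : DSep (restrictTo G W) X Y (insert j (Z \ {j})) := by rwa [hins]
      have hd₀ := hd'.of_insert_sink hj'
      have hZ₀ : Z \ {j} ⊆ W := Set.sdiff_subset.trans hZ
      have hXZ₀ : Disjoint X (Z \ {j}) := hXZ.mono_right Set.sdiff_subset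
      have hYZ₀ : Disjoint Y (Z \ {j}) := hYZ.mono_right Set.sdiff_subset
      have of_sep : ∀ {X Y : Set V}, X ⊆ W → Y ⊆ W → Disjoint X (Z \ {j}) → Disjoint Y (Z \ {j}) →
          DSep (restrictTo G W) X Y (Z \ {j}) → DSep (restrictTo G W) X {j} (Z \ {j}) →
          CI P Z X Y := by
        intro X Y hX hY hXZ hYZ h₁ h₂
        have := key' hX (Set.union_subset hY (Set.singleton_subset_iff.2 hjW)) hZ₀ hXZ
          (Set.disjoint_union_left.2 ⟨hYZ, by simp⟩) (h₁.union_right h₂) (Or.inr rfl)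
        have := this.weak_union (W := {j}) Set.subset_union_right
        rw [Set.sdiff_union_of_subset (Set.singleton_subset_iff.2 hjZ)] at this
        exact this.mono_right Set.subset_union_left
      rcases hd'.or_sink hj' with h | h
      · exact of_sep hX hY hXZ₀ hYZ₀ hd₀ h
      · exact (of_sep hY hX hYZ₀ hXZ₀ hd₀.symm h).symm
    · have hsub : ∀ {S : Set V}, S ⊆ W → j ∉ S → S ⊆ W \ {j} := fun hS hjS s hs =>
        ⟨hS hs, fun e => hjS (Set.mem_singleton_iff.1 e ▸ hs)⟩
      exact ih X Y Z (hsub hX hjX) (hsub hY hjY) (hsub hZ hjZ) hXZ hYZ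
        (hd.remove_sink (restrictTo_diff_sink_adj hj) hj')

end Markov

/-! ### Resampling coordinates of a product measure -/

section Resample

variable {V : Type*}

open scoped Classical in
/-- The point with the coordinates of `z.2` in `S` and those of `z.1` outside `S`. -/
noncomputable def mix {N : V → Type*} (S : Set V) (z : (∀ v, N v) × (∀ v, N v)) : ∀ v, N v :=
  fun v => if v ∈ S then z.2 v else z.1 v

theorem mix_of_mem {N : V → Type*} {S : Set V} {v : V} (hv : v ∈ S)
    (z : (∀ v, N v) × (∀ v, N v)) : mix S z v = z.2 v := if_pos hv

theorem mix_of_notMem {N : V → Type*} {S : Set V} {v : V} (hv : v ∉ S)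
    (z : (∀ v, N v) × (∀ v, N v)) : mix S z v = z.1 v := if_neg hv

theorem measurePreserving_mix [Fintype V] {N : V → Type*} [∀ v, MeasurableSpace (N v)]
    (ν : ∀ v, Measure (N v)) [∀ v, IsProbabilityMeasure (ν v)] (S : Set V) :
    MeasurePreserving (mix S) ((Measure.pi ν).prod (Measure.pi ν)) (Measure.pi ν) := by
  classical
  have hm : Measurable (mix S : (∀ v, N v) × (∀ v, N v) → ∀ v, N v) := by
    refine measurable_pi_lambda _ fun v => ?_
    by_cases hv : v ∈ S
    · simp only [mix_of_mem hv]; fun_prop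
    · simp only [mix_of_notMem hv]; fun_prop
  refine ⟨hm, (Measure.pi_eq fun s hs => ?_).symm⟩
  rw [Measure.map_apply hm (MeasurableSet.univ_pi hs)]
  have : mix S ⁻¹' (Set.univ.pi s) =
      (Set.univ.pi fun v => if v ∈ S then Set.univ else s v) ×ˢ
        (Set.univ.pi fun v => if v ∈ S then s v else Set.univ) := by
    ext z
    simp only [Set.mem_preimage, Set.mem_univ_pi, Set.mem_prod]
    rw [← forall_and]
    refine forall_congr' fun v => ?_
    by_cases hv : v ∈ S
    · simp [mix_of_mem hv, hv]
    · simp [mix_of_notMem hv, hv]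
  rw [this, Measure.prod_prod, Measure.pi_pi, Measure.pi_pi, ← Finset.prod_mul_distrib]
  refine Finset.prod_congr rfl fun v _ => ?_
  by_cases hv : v ∈ S <;> simp [hv]

variable [Fintype V] {Ω : V → Type u} [∀ v, MeasurableSpace (Ω v)]

theorem HasPositiveDensity.ae_eq {μ : ∀ v, Measure (Ω v)} {P : Measure (∀ v, Ω v)}
    (h : HasPositiveDensity μ P) : ae P = ae (Measure.pi μ) := by
  obtain ⟨p, hp, hpos, rfl⟩ := h
  ext s
  change (∀ᵐ x ∂_, x ∈ s) ↔ (∀ᵐ x ∂_, x ∈ s)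
  rw [ae_withDensity_iff hp]
  simp [(hpos _).ne']


theorem lintegral_lintegral_update [DecidableEq V] (μ : ∀ v, Measure (Ω v)) [∀ v, SigmaFinite (μ v)]
    (i : V) {f : (∀ v, Ω v) → ENNReal} (hf : Measurable f) :
    ∫⁻ t, ∫⁻ y, f (Function.update t i y) ∂μ i ∂Measure.pi μ =
      μ i Set.univ * ∫⁻ t, f t ∂Measure.pi μ := by
  rcases isEmpty_or_nonempty (∀ v, Ω v) with h | ⟨⟨x⟩⟩
  · simp [lintegral_of_isEmpty]
  have hg : Measurable fun t : ∀ v, Ω v => ∫⁻ y, f (Function.update t i y) ∂μ i :=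
    Measurable.lintegral_prod_right'
      (f := fun z : (∀ v, Ω v) × Ω i => f (Function.update z.1 i z.2))
      (hf.comp measurable_update')
  rw [lintegral_eq_lmarginal_univ (μ := μ) x, lintegral_eq_lmarginal_univ (μ := μ) x,
    lmarginal_erase' _ hg (Finset.mem_univ i), lmarginal_erase' _ hf (Finset.mem_univ i)]
  simp only [Function.update_idem, lintegral_const]
  rw [lmarginal, lmarginal, mul_comm]
  exact lintegral_mul_const _ (hg.comp measurable_updateFinset)

theorem ae_pi_iff_ae_ae_update [DecidableEq V] (μ : ∀ v, Measure (Ω v))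
    [∀ v, SigmaFinite (μ v)] {i : V} (hi : μ i ≠ 0) {B : Set (∀ v, Ω v)} (hB : MeasurableSet B) :
    (∀ᵐ t ∂Measure.pi μ, t ∈ B) ↔
      ∀ᵐ t ∂Measure.pi μ, ∀ᵐ y ∂μ i, Function.update t i y ∈ B := by
  have hf : Measurable (Bᶜ.indicator fun _ => (1 : ENNReal)) := measurable_const.indicator hB.compl
  have key := lintegral_lintegral_update μ i hf
  have hg : Measurable fun t : ∀ v, Ω v =>
      ∫⁻ y, (Bᶜ.indicator fun _ => (1 : ENNReal)) (Function.update t i y) ∂μ i :=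
    Measurable.lintegral_prod_right' (f := fun z : (∀ v, Ω v) × Ω i =>
      (Bᶜ.indicator fun _ => (1 : ENNReal)) (Function.update z.1 i z.2))
      (hf.comp measurable_update')
  have h1 : (∀ᵐ t ∂Measure.pi μ, t ∈ B) ↔
      ∫⁻ t, (Bᶜ.indicator fun _ => (1 : ENNReal)) t ∂Measure.pi μ = 0 := by
    rw [lintegral_indicator_const hB.compl, one_mul]; rfl
  have h2 : (∀ᵐ t ∂Measure.pi μ, ∀ᵐ y ∂μ i, Function.update t i y ∈ B) ↔
      ∫⁻ t, ∫⁻ y, (Bᶜ.indicator fun _ => (1 : ENNReal)) (Function.update t i y) ∂μ i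
        ∂Measure.pi μ = 0 := by
    rw [lintegral_eq_zero_iff hg]
    refine Filter.eventually_congr (Filter.Eventually.of_forall fun t => ?_)
    have hmeas : MeasurableSet (Function.update t i ⁻¹' Bᶜ) := measurable_update t hB.compl
    change _ ↔ ∫⁻ y, (Function.update t i ⁻¹' Bᶜ).indicator (fun _ => 1) y ∂μ i = 0
    rw [lintegral_indicator_const hmeas, one_mul]; rfl
  rw [h1, h2, key, mul_eq_zero]
  simp [hi]

theorem HasPositiveDensity.ne_zero {μ : ∀ v, Measure (Ω v)} [∀ v, SigmaFinite (μ v)]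
    {P : Measure (∀ v, Ω v)} [IsProbabilityMeasure P] (h : HasPositiveDensity μ P) (i : V) :
    μ i ≠ 0 := by
  intro hi
  have h0 : Measure.pi μ = 0 := by
    rw [← Measure.measure_univ_eq_zero, Measure.pi_univ]
    exact Finset.prod_eq_zero (Finset.mem_univ i) (by simp [hi])
  have := h.ae_eq
  rw [h0, ae_zero, ae_eq_bot] at this
  exact IsProbabilityMeasure.ne_zero P this

/-- Under a law with positive density, resampling one coordinate from the reference measure does not
change the null sets. -/
theorem HasPositiveDensity.ae_iff_ae_ae_update [DecidableEq V] {μ : ∀ v, Measure (Ω v)}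
    [∀ v, SigmaFinite (μ v)] {P : Measure (∀ v, Ω v)} [IsProbabilityMeasure P]
    (h : HasPositiveDensity μ P) (i : V)
    {B : Set (∀ v, Ω v)} (hB : MeasurableSet B) :
    (∀ᵐ t ∂P, t ∈ B) ↔ ∀ᵐ t ∂P, ∀ᵐ y ∂μ i, Function.update t i y ∈ B := by
  rw [h.ae_eq]
  exact ae_pi_iff_ae_ae_update μ (h.ne_zero i) hB

end Resample

/-! ### Functions of some of the coordinates -/

section Coord

variable {V : Type*} {Ω : V → Type u} [∀ v, MeasurableSpace (Ω v)] {S T : Set V}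

theorem measurable_coordSigma_eval {v : V} (hv : v ∈ S) :
    Measurable[coordSigma Ω S] (fun t : ∀ v, Ω v => t v) :=
  (comap_measurable _).mono
    (le_iSup₂ (f := fun v (_ : v ∈ S) =>
      MeasurableSpace.comap (fun x : ∀ v, Ω v => x v) inferInstance) v hv) le_rfl

theorem measurable_coordSigma_of_eval {α : Type*} {m : MeasurableSpace α} {f : α → ∀ v, Ω v}
    (hf : ∀ v ∈ S, Measurable[m] fun x => f x v) : Measurable[m, coordSigma Ω S] f := by
  rw [measurable_iff_comap_le]
  simp only [MeasurableSpace.comap_iSup, MeasurableSpace.comap_comp, iSup_le_iff]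
  exact fun v hv => (hf v hv).comap_le

theorem measurable_coordSigma_restrict {ι : V → Prop} (h : ∀ v, ι v → v ∈ S) :
    Measurable[coordSigma Ω S] (fun (t : ∀ v, Ω v) (p : {v // ι v}) => t p) :=
  @measurable_pi_lambda _ _ _ (coordSigma Ω S) _ _
    fun p => measurable_coordSigma_eval (h p p.2)

/-- An event that is determined by the variables in `S` does not distinguish between points with
the same coordinates in `S`. -/
theorem mem_iff_of_measurableSet_coordSigma {A : Set (∀ v, Ω v)}
    (hA : MeasurableSet[coordSigma Ω S] A) {x y : ∀ v, Ω v} (h : ∀ v ∈ S, x v = y v) :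
    x ∈ A ↔ y ∈ A := by
  have hle : coordSigma Ω S ≤ MeasurableSpace.comap
      (fun (t : ∀ v, Ω v) (p : {v // v ∈ S}) => t p) inferInstance :=
    iSup₂_le fun v hv => by
      have : (fun t : ∀ v, Ω v => t v) =
          (fun s : ∀ p : {v // v ∈ S}, Ω p => s ⟨v, hv⟩) ∘ (fun t p => t p) := rfl
      rw [this, ← MeasurableSpace.comap_comp]
      exact MeasurableSpace.comap_mono
        (measurable_pi_apply (X := fun p : {v // v ∈ S} => Ω p) ⟨v, hv⟩).comap_le
  obtain ⟨A', -, rfl⟩ := hle A hA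
  have : (fun p : {v // v ∈ S} => x p) = fun p : {v // v ∈ S} => y p :=
    funext fun p => h p p.2
  simp only [Set.mem_preimage, this]

theorem exists_eq_preimage_of_coordSigma_singleton {k : V} {t : Set (∀ v, Ω v)}
    (ht : MeasurableSet[coordSigma Ω {k}] t) :
    ∃ B : Set (Ω k), MeasurableSet B ∧ t = {x | x k ∈ B} := by
  rw [coordSigma, iSup_singleton] at ht
  obtain ⟨B, hB, rfl⟩ := ht
  exact ⟨B, hB, rfl⟩

theorem measurable_coordSigma_update [DecidableEq V] (j : V) (x : Ω j) :
    Measurable[coordSigma Ω (S \ {j}), coordSigma Ω S] fun t => Function.update t j x := by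
  refine @measurable_coordSigma_of_eval _ _ _ _ _ (coordSigma Ω (S \ {j})) _ fun v hv => ?_
  by_cases hvj : v = j
  · subst hvj
    simp only [Function.update_self]
    exact measurable_const
  · simp only [Function.update_of_ne hvj]
    exact measurable_coordSigma_eval ⟨hv, hvj⟩

end Coord

end CausalModel

namespace SCM

open CausalModel

/-! ### Solutions of a structural causal model -/

section Solve

variable {V : Type*} {Ω : V → Type u} [∀ v, MeasurableSpace (Ω v)]
  (C : SCM.{u, w} V Ω)

theorem isAncestral_compl_descendants (i : V) :
    IsAncestral C.graph {v | ¬ Relation.TransGen C.graph.Adj i v} :=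
  fun _ _ hab hb ha => hb (ha.tail hab)

variable [Finite V]

/-- The values of the variables in an ancestral set are determined by the interventions on this set
and the noise of its remaining variables. -/
theorem solve_congr {T : Set V} (hT : IsAncestral C.graph T) {a a' : ∀ v, Option (Ω v)}
    {n n' : ∀ v, C.Noise v} (ha : ∀ v ∈ T, a v = a' v) (hn : ∀ v ∈ T, a v = none → n v = n' v) :
    ∀ v ∈ T, C.solve a n v = C.solve a' n' v := by
  intro v
  induction v using C.wellFounded.induction with
  | _ v ih =>
    intro hv
    rw [solve_eq, solve_eq, ← ha v hv]
    cases hav : a v with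
    | some x => rfl
    | none =>
      simp only [Option.getD_none]
      rw [hn v hv hav]
      congr 1
      exact funext fun p => ih p.1 p.2 (hT _ _ p.2 hv)

theorem eq_solve {a : ∀ v, Option (Ω v)} {n : ∀ v, C.Noise v} {x : ∀ v, Ω v}
    (hx : ∀ v, x v = (a v).getD (C.assign v (fun p => x p.1) (n v))) : x = C.solve a n := by
  funext v
  induction v using C.wellFounded.induction with
  | _ v ih =>
    rw [hx v, solve_eq]
    congr 2
    exact funext fun p => ih p.1 p.2

open scoped Classical in
/-- The values of all variables when those which are not proper descendants of `i` are set to their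
values in `z.1`, and the noise of the proper descendants of `i` is taken from `z.2`. -/
noncomputable def propagate (i : V) (z : (∀ v, Ω v) × (∀ v, C.Noise v)) : ∀ v, Ω v :=
  C.solve (fun v => if Relation.TransGen C.graph.Adj i v then none else some (z.1 v)) z.2

theorem propagate_apply_of_notMem {i v : V} (hv : ¬ Relation.TransGen C.graph.Adj i v)
    (z : (∀ v, Ω v) × (∀ v, C.Noise v)) : C.propagate i z v = z.1 v := by
  rw [propagate, solve_eq, if_neg hv]; rfl

theorem propagate_apply_of_mem {i v : V} (hv : Relation.TransGen C.graph.Adj i v)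
    (z : (∀ v, Ω v) × (∀ v, C.Noise v)) :
    C.propagate i z v = C.assign v (fun p => C.propagate i z p.1) (z.2 v) := by
  rw [propagate, solve_eq, if_pos hv]; rfl

theorem measurable_propagate (i : V) : Measurable (C.propagate i) := by
  refine measurable_pi_lambda _ fun v => ?_
  induction v using C.wellFounded.induction with
  | _ v ih =>
    by_cases hv : Relation.TransGen C.graph.Adj i v
    · simp only [propagate_apply_of_mem C hv]
      exact (C.measurable_assign v).comp
        ((measurable_pi_lambda _ fun p => ih p.1 p.2).prodMk
          ((measurable_pi_apply v).comp measurable_snd))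
    · simp only [propagate_apply_of_notMem C hv]
      exact (measurable_pi_apply v).comp measurable_fst

theorem propagate_congr (i : V) {z z' : (∀ v, Ω v) × (∀ v, C.Noise v)}
    (h1 : ∀ v, ¬ Relation.TransGen C.graph.Adj i v → z.1 v = z'.1 v)
    (h2 : ∀ v, Relation.TransGen C.graph.Adj i v → z.2 v = z'.2 v) :
    C.propagate i z = C.propagate i z' := by
  funext v
  refine C.solve_congr (T := Set.univ) (fun _ _ _ _ => trivial) (fun v _ => ?_)
    (fun v _ hv => ?_) v trivial
  · by_cases hv : Relation.TransGen C.graph.Adj i v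
    · simp [hv]
    · simp [hv, h1 v hv]
  · refine h2 v ?_
    by_contra hv'
    simp [hv'] at hv

theorem propagate_solve (i : V) (n : ∀ v, C.Noise v) :
    C.propagate i (C.solve (fun _ => none) n, n) = C.solve (fun _ => none) n := by
  refine (C.eq_solve fun v => ?_).symm
  by_cases hv : Relation.TransGen C.graph.Adj i v
  · rw [if_pos hv, solve_eq]
  · rw [if_neg hv]; rfl

theorem propagate_update_solve [DecidableEq V] (i : V) (x : Ω i) (n : ∀ v, C.Noise v) :
    C.propagate i (Function.update (C.solve (fun _ => none) n) i x, n) =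
      C.solve (Function.update (fun _ => none) i (some x)) n := by
  refine (C.eq_solve fun v => ?_).symm
  by_cases hvi : v = i
  · subst hvi
    rw [solve_eq, if_neg (C.acyclic v)]
    simp
  by_cases hv : Relation.TransGen C.graph.Adj i v
  · rw [if_pos hv, solve_eq]
    simp [hvi]
  · rw [if_neg hv]
    simp only [Function.update_of_ne hvi, Option.getD_some]
    refine C.solve_congr (T := {v | ¬ Relation.TransGen C.graph.Adj i v ∧ v ≠ i})
      (fun a b hab hb => ⟨fun ha => hb.1 (ha.tail hab), ?_⟩) (fun v hv => ?_) (fun _ _ _ => rfl)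
      v ⟨hv, hvi⟩
    · rintro rfl
      exact hb.1 (Relation.TransGen.single hab)
    · rw [Function.update_of_ne hv.2]

end Solve

/-! ### Laws of a structural causal model -/

section Law

variable {V : Type*} {Ω : V → Type u} [∀ v, MeasurableSpace (Ω v)]

/-- The probability that the assignment of `k`, applied to the values of the parents of `k` in `t`,
yields a value in `B`. -/
noncomputable def assignProb (C : SCM.{u, w} V Ω) (k : V) (B : Set (Ω k)) (t : ∀ v, Ω v) :
    ENNReal :=
  C.noiseLaw k {n | C.assign k (fun p => t p) n ∈ B}

variable (C : SCM.{u, w} V Ω) {k : V} {B : Set (Ω k)}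

theorem assignProb_congr {t t' : ∀ v, Ω v} (h : ∀ v, C.graph.Adj v k → t v = t' v) :
    C.assignProb k B t = C.assignProb k B t' := by
  have : (fun p : {p // C.graph.Adj p k} => t p) = fun p : {p // C.graph.Adj p k} => t' p :=
    funext fun p => h p p.2
  rw [assignProb, assignProb, this]

theorem assignProb_le_one (t : ∀ v, Ω v) : C.assignProb k B t ≤ 1 := prob_le_one

theorem measurable_assignProb (hB : MeasurableSet B) :
    Measurable[coordSigma Ω {p | C.graph.Adj p k}] (C.assignProb k B) :=
  (measurable_measure_prodMk_left (ν := C.noiseLaw k) ((C.measurable_assign k) hB)).comp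
    (measurable_coordSigma_restrict (S := {p | C.graph.Adj p k}) fun _ h => h)

variable [Fintype V]

/-- Given an ancestral set of variables that contains the parents of `k` but not `k`, the variable
`k` is distributed as its assignment prescribes, unless it is intervened on. -/
theorem law_inter {a : ∀ v, Option (Ω v)} (hak : a k = none) {T : Set V}
    (hT : IsAncestral C.graph T) (hkT : k ∉ T) (hpa : {p | C.graph.Adj p k} ⊆ T)
    {A : Set (∀ v, Ω v)} (hA : MeasurableSet[coordSigma Ω T] A) (hB : MeasurableSet B) :
    C.law a (A ∩ {t | t k ∈ B}) = ∫⁻ t in A, C.assignProb k B t ∂C.law a := by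
  have hA' : MeasurableSet A := coordSigma_le Ω T _ hA
  have hBk : MeasurableSet {t : ∀ v, Ω v | t k ∈ B} := measurable_pi_apply k hB
  have hκ : Measurable (C.assignProb k B) :=
    (C.measurable_assignProb hB).mono (coordSigma_le Ω _) le_rfl
  have hs := C.measurable_solve a
  have hE : MeasurableSet (C.solve a ⁻¹' (A ∩ {t | t k ∈ B})) := hs (hA'.inter hBk)
  have hmix := measurePreserving_mix C.noiseLaw {k}
  -- resample the noise of `k`, which does not affect the variables in `T`
  rw [law, Measure.map_apply hs (hA'.inter hBk), ← lintegral_indicator hA',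
    lintegral_map (hκ.indicator hA') hs, ← hmix.measure_preimage hE.nullMeasurableSet,
    Measure.prod_apply (hmix.measurable hE)]
  refine lintegral_congr fun n => ?_
  have hsol : ∀ n', ∀ v ∈ T, C.solve a (mix {k} (n, n')) v = C.solve a n v := fun n' =>
    C.solve_congr hT (fun _ _ => rfl) fun v hv _ =>
      mix_of_notMem (fun h => hkT (by rwa [Set.mem_singleton_iff.1 h] at hv)) _
  have hmem : ∀ n', C.solve a (mix {k} (n, n')) ∈ A ↔ C.solve a n ∈ A := fun n' =>
    mem_iff_of_measurableSet_coordSigma hA (hsol n')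
  have hval : ∀ n', C.solve a (mix {k} (n, n')) k =
      C.assign k (fun p => C.solve a n p) (n' k) := by
    intro n'
    rw [solve_eq, hak, Option.getD_none, mix_of_mem (Set.mem_singleton k)]
    congr 1
    exact funext fun p => hsol n' p (hpa p.2)
  by_cases hnA : C.solve a n ∈ A
  · rw [Set.indicator_of_mem hnA, assignProb]
    have hset : Prod.mk n ⁻¹' (mix {k} ⁻¹' (C.solve a ⁻¹' (A ∩ {t | t k ∈ B}))) =
        (fun n' : ∀ v, C.Noise v => n' k) ⁻¹'
          {e | C.assign k (fun p => C.solve a n p) e ∈ B} := by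
      ext n'
      simp [hmem, hnA, hval]
    rw [hset, (measurePreserving_eval C.noiseLaw k).measure_preimage]
    exact (((C.measurable_assign k).comp measurable_prodMk_left) hB).nullMeasurableSet
  · rw [Set.indicator_of_notMem hnA]
    have hset : Prod.mk n ⁻¹' (mix {k} ⁻¹' (C.solve a ⁻¹' (A ∩ {t | t k ∈ B}))) = ∅ := by
      ext n'
      simp [hmem, hnA]
    rw [hset, measure_empty]

theorem ae_law_iff {a : ∀ v, Option (Ω v)} {E : Set (∀ v, Ω v)} (hE : MeasurableSet E) :
    (∀ᵐ t ∂C.law a, t ∈ E) ↔ ∀ᵐ n ∂Measure.pi C.noiseLaw, C.solve a n ∈ E :=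
  ae_map_iff (p := (· ∈ E)) (C.measurable_solve a).aemeasurable hE

/-- The laws under two interventions agree on an ancestral set of variables on which the
interventions agree. -/
theorem law_apply_congr {a a' : ∀ v, Option (Ω v)} {T : Set V} (hT : IsAncestral C.graph T)
    (ha : ∀ v ∈ T, a v = a' v) {A : Set (∀ v, Ω v)} (hA : MeasurableSet[coordSigma Ω T] A) :
    C.law a A = C.law a' A := by
  have hA' : MeasurableSet A := coordSigma_le Ω T _ hA
  rw [law, law, Measure.map_apply (C.measurable_solve a) hA',
    Measure.map_apply (C.measurable_solve a') hA']
  congr 1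
  ext n
  exact mem_iff_of_measurableSet_coordSigma hA (C.solve_congr hT ha fun _ _ _ => rfl)

variable [DecidableEq V]

theorem ae_doLaw_eq [∀ v, MeasurableSingletonClass (Ω v)] (i : V) (x : Ω i) :
    ∀ᵐ t ∂C.doLaw i x, t i = x := by
  have hm : MeasurableSet {t : ∀ v, Ω v | t i = x} :=
    measurable_pi_apply i (MeasurableSet.singleton x)
  refine (C.ae_law_iff hm).2 (Filter.Eventually.of_forall fun n => ?_)
  rw [Set.mem_ofPred_eq]
  rw [solve_eq]
  simp

/-- If the observational law has a positive density, an event which is almost sure under all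
interventions on `i` is almost sure under the observational law: the value of `i` that arises
naturally is, for given values of the non-descendants of `i`, absolutely continuous with respect to
the reference measure, and the descendants of `i` react to it as they do to an intervention. -/
theorem ae_obsLaw_of_forall_ae_doLaw {μ : ∀ v, Measure (Ω v)} [∀ v, SigmaFinite (μ v)]
    (hpos : HasPositiveDensity μ C.obsLaw) (i : V) {E : Set (∀ v, Ω v)} (hE : MeasurableSet E)
    (h : ∀ x, ∀ᵐ t ∂C.doLaw i x, t ∈ E) : ∀ᵐ t ∂C.obsLaw, t ∈ E := by
  set X : (∀ v, C.Noise v) → ∀ v, Ω v := C.solve fun _ => none with hX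
  have hXm : Measurable X := C.measurable_solve _
  have hmix := measurePreserving_mix C.noiseLaw {v | Relation.TransGen C.graph.Adj i v}
  have hXmix : ∀ z v, ¬ Relation.TransGen C.graph.Adj i v →
      X (mix {v | Relation.TransGen C.graph.Adj i v} z) v = X z.1 v := fun z =>
    C.solve_congr (C.isAncestral_compl_descendants i) (fun _ _ => rfl)
      fun v hv _ => mix_of_notMem hv z
  have hupd : Measurable fun q : (∀ v, Ω v) × Ω i => Function.update q.1 i q.2 := measurable_update'
  -- the noise of the descendants of `i` can be resampled independently of the other variables
  have h1 : ∀ x, ∀ᵐ z ∂(Measure.pi C.noiseLaw).prod (Measure.pi C.noiseLaw),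
      C.propagate i (Function.update (X z.1) i x, z.2) ∈ E := by
    intro x
    have hx := (C.ae_law_iff hE).1 (h x)
    filter_upwards [hmix.quasiMeasurePreserving.ae hx] with z hz
    rw [← C.propagate_update_solve] at hz
    convert hz using 1
    refine C.propagate_congr i (fun v hv => ?_) fun v hv => (mix_of_mem hv z).symm
    by_cases hvi : v = i
    · subst hvi; simp
    · simpa [Function.update_of_ne hvi] using (hXmix z v hv).symm
  have h2 : ∀ᵐ z ∂(Measure.pi C.noiseLaw).prod (Measure.pi C.noiseLaw), ∀ᵐ x ∂μ i,
      C.propagate i (Function.update (X z.1) i x, z.2) ∈ E := by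
    refine (Measure.ae_ae_comm ?_).1 (Filter.Eventually.of_forall h1)
    refine ((C.measurable_propagate i).comp (Measurable.prodMk (hupd.comp
      ((hXm.comp (measurable_fst.comp measurable_snd)).prodMk measurable_fst))
      (measurable_snd.comp measurable_snd))) hE
  have h3 : ∀ᵐ n' ∂Measure.pi C.noiseLaw, ∀ᵐ n ∂Measure.pi C.noiseLaw, ∀ᵐ x ∂μ i,
      C.propagate i (Function.update (X n) i x, n') ∈ E :=
    Measure.ae_ae_of_ae_prod ((Measure.measurePreserving_swap).quasiMeasurePreserving.ae h2)
  -- by positivity, the random value `x` can be replaced by the natural value of `i`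
  have h4 : ∀ᵐ n' ∂Measure.pi C.noiseLaw, ∀ᵐ n ∂Measure.pi C.noiseLaw,
      C.propagate i (X n, n') ∈ E := by
    filter_upwards [h3] with n' hn'
    have hm : MeasurableSet {t : ∀ v, Ω v | C.propagate i (t, n') ∈ E} :=
      ((C.measurable_propagate i).comp (measurable_id.prodMk measurable_const)) hE
    have hiff := hpos.ae_iff_ae_ae_update i hm
    have hT : ∀ᵐ t ∂C.obsLaw, t ∈ {t : ∀ v, Ω v | C.propagate i (t, n') ∈ E} := by
      refine hiff.2 ?_
      have hmm : MeasurableSet {t : ∀ v, Ω v | ∀ᵐ x ∂μ i, Function.update t i x ∈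
          {t : ∀ v, Ω v | C.propagate i (t, n') ∈ E}} :=
        measurableSet_eq_fun (measurable_measure_prodMk_left (ν := μ i) (hupd hm.compl))
          measurable_const
      exact (C.ae_law_iff hmm).2 hn'
    exact (C.ae_law_iff hm).1 hT
  have h5 : ∀ᵐ z ∂(Measure.pi C.noiseLaw).prod (Measure.pi C.noiseLaw),
      C.propagate i (X z.1, z.2) ∈ E := by
    have hm : MeasurableSet {z : (∀ v, C.Noise v) × (∀ v, C.Noise v) |
        C.propagate i (X z.1, z.2) ∈ E} :=
      ((C.measurable_propagate i).comp
        ((hXm.comp measurable_fst).prodMk measurable_snd)) hE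
    refine (Measure.ae_prod_iff_ae_ae hm).2 ?_
    exact (Measure.ae_ae_comm hm).2 h4
  have h6 : ∀ᵐ n ∂Measure.pi C.noiseLaw, X n ∈ E := by
    rw [← hmix.map_eq, ae_map_iff (p := fun n => X n ∈ E) hmix.measurable.aemeasurable (hXm hE)]
    filter_upwards [h5] with z hz
    rw [hX, ← C.propagate_solve i]
    convert hz using 1
    exact C.propagate_congr i (fun v hv => hXmix z v hv) fun v hv => mix_of_mem hv z
  exact (C.ae_law_iff hE).2 h6

end Law

/-! ### Causal minimality and interventions -/

section Minimal

variable {V : Type*} [Fintype V] {Ω : V → Type u} [∀ v, MeasurableSpace (Ω v)]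
  (C : SCM.{u, w} V Ω)

/-- If the conditional law of `k` given its possible predecessors is a function of the variables in
`Z` alone, then `Z` screens `k` off from these predecessors. -/
theorem ci_of_assignProb_ae_eq [∀ v, StandardBorelSpace (Ω v)] {k : V} {T Z : Set V}
    (hT : IsAncestral C.graph T) (hkT : k ∉ T) (hpa : {p | C.graph.Adj p k} ⊆ T) (hZT : Z ⊆ T)
    (h : ∀ B : Set (Ω k), MeasurableSet B → ∃ g : (∀ v, Ω v) → ENNReal,
      Measurable[coordSigma Ω Z] g ∧ C.assignProb k B =ᵐ[C.obsLaw] g) :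
    CI C.obsLaw Z {k} T := by
  rw [ci_iff, Set.union_eq_self_of_subset_left hZT]
  intro t ht
  obtain ⟨B, hB, rfl⟩ := exists_eq_preimage_of_coordSigma_singleton ht
  obtain ⟨g, hg, hκg⟩ := h B hB
  have hTm := coordSigma_le Ω T
  have hZm := coordSigma_le Ω Z
  have hκ := C.measurable_assignProb hB
  have hκm : Measurable (C.assignProb k B) := hκ.mono (coordSigma_le Ω _) le_rfl
  have hBk : MeasurableSet {t : ∀ v, Ω v | t k ∈ B} := measurable_pi_apply k hB
  have hκi : Integrable (fun t => (C.assignProb k B t).toReal) C.obsLaw := by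
    refine Integrable.of_bound hκm.ennreal_toReal.aestronglyMeasurable 1
      (Filter.Eventually.of_forall fun t => ?_)
    rw [Real.norm_of_nonneg ENNReal.toReal_nonneg]
    exact ENNReal.toReal_mono ENNReal.one_ne_top (C.assignProb_le_one t)
  have hκsm : StronglyMeasurable[coordSigma Ω T] fun t => (C.assignProb k B t).toReal :=
    (Measurable.ennreal_toReal (hκ.mono (coordSigma_mono hpa) le_rfl)).stronglyMeasurable
  have h1 : (fun t => (C.assignProb k B t).toReal) =ᵐ[C.obsLaw]
      C.obsLaw[{t : ∀ v, Ω v | t k ∈ B}.indicator (fun _ => (1 : ℝ)) | coordSigma Ω T] := by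
    refine ae_eq_condExp_of_forall_setIntegral_eq hTm (integrable_indicator_one hBk)
      (fun _ _ _ => hκi.integrableOn) (fun A hA _ => ?_) hκsm.aestronglyMeasurable
    rw [integral_toReal hκm.aemeasurable
      (Filter.Eventually.of_forall fun t => (C.assignProb_le_one t).trans_lt ENNReal.one_lt_top),
      ← C.law_inter rfl hT hkT hpa hA hB, setIntegral_indicator hBk]
    simp [Measure.real]
  have hκg' : (fun t => (C.assignProb k B t).toReal) =ᵐ[C.obsLaw] fun t => (g t).toReal := by
    filter_upwards [hκg] with t ht
    rw [ht]
  have hgsm : StronglyMeasurable[coordSigma Ω Z] fun t => (g t).toReal :=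
    (Measurable.ennreal_toReal hg).stronglyMeasurable
  have h2 := h1.symm.trans hκg'
  have h3 := (condExp_condExp_of_le (coordSigma_mono hZT) hTm).symm.trans
    (condExp_congr_ae (m := coordSigma Ω Z) h2)
  rw [condExp_of_stronglyMeasurable hZm hgsm (hκi.congr hκg')] at h3
  exact h2.trans h3.symm

variable [DecidableEq V]

/-- If the law of the assignment of `k` coincides, under every intervention on the parent `i`, with
a quantity that does not depend on the value of `i`, then the edge from `i` to `k` is superfluous,
which causal minimality excludes. -/
theorem false_of_assignProb_ae_eq [∀ v, StandardBorelSpace (Ω v)] {μ : ∀ v, Measure (Ω v)}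
    [∀ v, SigmaFinite (μ v)] (hpos : HasPositiveDensity μ C.obsLaw)
    (hmin : CausallyMinimal C.graph C.obsLaw) {i k : V} (hik : C.graph.Adj i k)
    (h : ∀ B : Set (Ω k), MeasurableSet B → ∃ L : (∀ v, Ω v) → ENNReal, Measurable L ∧
      (∀ t y, L (Function.update t i y) = L t) ∧
      ∀ x, ∀ᵐ t ∂C.doLaw i x, C.assignProb k B t = L t) : False := by
  set G' : Digraph V := ⟨fun a b => C.graph.Adj a b ∧ ¬ (a = i ∧ b = k)⟩ with hG'
  have hle : G' ≤ C.graph := fun _ _ hab => hab.1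
  refine hmin.2 G' (lt_of_le_not_ge hle fun hge => (hge hik).2 ⟨rfl, rfl⟩) ?_
  refine globalMarkov_of_local hle C.acyclic fun k' T hT hkT hpa => ?_
  refine C.ci_of_assignProb_ae_eq hT hkT hpa (fun p hp => hpa hp.1) fun B hB => ?_
  by_cases hk : k' = k
  · subst hk
    obtain ⟨L, hL, hLi, hLae⟩ := h B hB
    have hκ := C.measurable_assignProb hB
    have hκm : Measurable (C.assignProb k' B) := hκ.mono (coordSigma_le Ω _) le_rfl
    have hE : MeasurableSet {t | C.assignProb k' B t = L t} := measurableSet_eq_fun hκm hL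
    have h1 : ∀ᵐ t ∂C.obsLaw, C.assignProb k' B t = L t :=
      C.ae_obsLaw_of_forall_ae_doLaw hpos i hE hLae
    have h2 := (hpos.ae_iff_ae_ae_update i hE).1 h1
    have hupd : Measurable fun q : (∀ v, Ω v) × Ω i => Function.update q.1 i q.2 :=
      measurable_update'
    have h3 := (Measure.ae_ae_comm (p := fun t y => Function.update t i y ∈
      {t | C.assignProb k' B t = L t}) (hupd hE)).1 h2
    have : NeZero (μ i) := ⟨hpos.ne_zero i⟩
    obtain ⟨y, hy⟩ := h3.exists
    -- almost surely, the assignment behaves as if `i` had the value `y`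
    refine ⟨fun t => C.assignProb k' B (Function.update t i y), ?_, ?_⟩
    · have hm := hκ.comp (measurable_coordSigma_update (S := {p | C.graph.Adj p k'}) i y)
      refine hm.mono (coordSigma_mono fun p hp => ⟨hp.1, fun hpi => hp.2 hpi.1⟩) le_rfl
    · filter_upwards [h1, hy] with t ht hty
      have hty' : C.assignProb k' B (Function.update t i y) = L (Function.update t i y) := hty
      rw [ht, hty', hLi]
  · refine ⟨C.assignProb k' B, (C.measurable_assignProb hB).mono (coordSigma_mono fun p hp => ?_)
      le_rfl, Filter.EventuallyEq.rfl⟩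
    exact ⟨hp, fun hpk => hk hpk.2⟩

/-- The law of the assignment of `k` is determined, under an intervention on `i`, by the
conditional law of `k` given its possible predecessors other than `i`. -/
theorem assignProb_ae_eq_of_law_inter [∀ v, MeasurableSingletonClass (Ω v)] {i k : V} {x : Ω i}
    {T : Set V} (hki : k ≠ i) (hT : IsAncestral C.graph T) (hkT : k ∉ T)
    (hpa : {p | C.graph.Adj p k} ⊆ T) {B : Set (Ω k)} (hB : MeasurableSet B)
    {g : (∀ v, Ω v) → ENNReal} (hg : Measurable[coordSigma Ω (T \ {i})] g)
    (h : ∀ A, MeasurableSet[coordSigma Ω (T \ {i})] A →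
      C.doLaw i x (A ∩ {t | t k ∈ B}) = ∫⁻ t in A, g t ∂C.doLaw i x) :
    ∀ᵐ t ∂C.doLaw i x, C.assignProb k B t = g t := by
  have hm := coordSigma_le Ω (T \ {i})
  have hae : ∀ᵐ t ∂C.doLaw i x,
      C.assignProb k B (Function.update t i x) = C.assignProb k B t := by
    filter_upwards [C.ae_doLaw_eq i x] with t ht
    rw [← ht, Function.update_eq_self]
  have hκ : Measurable[coordSigma Ω (T \ {i})]
      fun t => C.assignProb k B (Function.update t i x) :=
    (C.measurable_assignProb hB).comp
      ((measurable_coordSigma_update (S := T) i x).mono le_rfl (coordSigma_mono hpa))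
  have heq : (fun t => C.assignProb k B (Function.update t i x)) =ᵐ[(C.doLaw i x).trim hm] g := by
    refine ae_eq_of_forall_setLIntegral_eq_of_sigmaFinite hκ hg fun A hA _ => ?_
    rw [setLIntegral_trim hm hκ hA, setLIntegral_trim hm hg hA, ← h A hA,
      C.law_inter (by simp [hki]) hT hkT hpa (coordSigma_mono Set.sdiff_subset _ hA) hB]
    exact lintegral_congr_ae (ae_restrict_of_ae hae)
  filter_upwards [hae, ae_eq_of_ae_eq_trim heq] with t h1 h2
  rw [← h1, h2]

end Minimal

/-! ### Comparison of two models -/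

section Compare

variable {V : Type*} [Fintype V] [DecidableEq V] {Ω : V → Type u} [∀ v, MeasurableSpace (Ω v)]
  [∀ v, StandardBorelSpace (Ω v)] {μ : ∀ v, Measure (Ω v)} [∀ v, SigmaFinite (μ v)]
  {C : SCM.{u, w₁} V Ω} {D : SCM.{u, w₂} V Ω}

/-- A sink of the first model within a common ancestral set is a sink of the second: interventions
on it do not affect the other variables of the set. -/
theorem sink_of_interventionalDistanceZero (hpos : HasPositiveDensity μ D.obsLaw)
    (hmin : CausallyMinimal D.graph D.obsLaw) (hID : InterventionalDistanceZero C D) {W : Set V}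
    (hCW : IsAncestral C.graph W) (hDW : IsAncestral D.graph W) {j : V}
    (hj : ∀ v ∈ W, ¬ C.graph.Adj j v) : ∀ v ∈ W, ¬ D.graph.Adj j v := by
  intro k hkW hjk
  obtain ⟨t₀⟩ : Nonempty (∀ v, Ω v) := nonempty_of_isProbabilityMeasure D.obsLaw
  have hkj : k ≠ j := by
    rintro rfl
    exact D.acyclic k (Relation.TransGen.single hjk)
  have hinv : ∀ (x : Ω j) (A : Set (∀ v, Ω v)), MeasurableSet[coordSigma Ω (W \ {j})] A →
      D.doLaw j x A = D.doLaw j (t₀ j) A := by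
    intro x A hA
    rw [← hID, ← hID]
    refine C.law_apply_congr (hCW.diff_sink hj) (fun v hv => ?_) hA
    have hvj : v ≠ j := hv.2
    simp [hvj]
  set T : Set V := {v | Relation.TransGen D.graph.Adj v k} with hTdef
  have hTW : T ⊆ W := fun v hv => by
    induction hv using Relation.TransGen.head_induction_on with
    | single h => exact hDW _ _ h hkW
    | head h _ ih => exact hDW _ _ h ih
  have hT : IsAncestral D.graph T := fun a b hab hb => Relation.TransGen.head hab hb
  have hkT : k ∉ T := D.acyclic k
  have hpa : {p | D.graph.Adj p k} ⊆ T := fun p hp => Relation.TransGen.single hp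
  have hmW := coordSigma_le Ω (W \ {j})
  refine D.false_of_assignProb_ae_eq hpos hmin hjk fun B hB => ?_
  have hg : Measurable[coordSigma Ω (T \ {j})]
      fun t => D.assignProb k B (Function.update t j (t₀ j)) :=
    (D.measurable_assignProb hB).comp
      ((measurable_coordSigma_update (S := T) j (t₀ j)).mono le_rfl (coordSigma_mono hpa))
  refine ⟨_, hg.mono (coordSigma_le Ω _) le_rfl, fun t y => by rw [Function.update_idem],
    fun x => D.assignProb_ae_eq_of_law_inter hkj hT hkT hpa hB hg fun A hA => ?_⟩
  have hTW' : T \ {j} ⊆ W \ {j} := Set.sdiff_subset_sdiff_left hTW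
  have hAW := coordSigma_mono (Ω := Ω) hTW' A hA
  have hgW := hg.mono (coordSigma_mono hTW') le_rfl
  have hk : MeasurableSet[coordSigma Ω (W \ {j})] {t : ∀ v, Ω v | t k ∈ B} :=
    measurable_coordSigma_eval (S := W \ {j}) (v := k) ⟨hkW, hkj⟩ hB
  have htrim : (D.doLaw j x).trim hmW = (D.doLaw j (t₀ j)).trim hmW := by
    refine @Measure.ext _ (coordSigma Ω (W \ {j})) _ _ fun E hE => ?_
    rw [trim_measurableSet_eq hmW hE, trim_measurableSet_eq hmW hE, hinv x E hE]
  rw [hinv x _ (MeasurableSet.inter hAW hk), ← setLIntegral_trim hmW hgW hAW, htrim,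
    setLIntegral_trim hmW hgW hAW,
    D.law_inter (by simp [hkj]) hT hkT hpa (coordSigma_mono Set.sdiff_subset _ hA) hB]
  refine lintegral_congr_ae (ae_restrict_of_ae ?_)
  filter_upwards [D.ae_doLaw_eq j (t₀ j)] with t ht
  rw [← ht, Function.update_eq_self]

/-- A common sink of a common ancestral set has no parent in the first model which is not a parent
in the second. -/
theorem adj_of_interventionalDistanceZero (hpos : HasPositiveDensity μ C.obsLaw)
    (hmin : CausallyMinimal C.graph C.obsLaw) (hID : InterventionalDistanceZero C D) {W : Set V}
    (hCW : IsAncestral C.graph W) (hDW : IsAncestral D.graph W) {i j : V} (hjW : j ∈ W)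
    (hCj : ∀ v ∈ W, ¬ C.graph.Adj j v) (hDj : ∀ v ∈ W, ¬ D.graph.Adj j v)
    (hij : C.graph.Adj i j) : D.graph.Adj i j := by
  by_contra hDij
  have hji : j ≠ i := by
    rintro rfl
    exact C.acyclic j (Relation.TransGen.single hij)
  have hCT := hCW.diff_sink hCj
  have hDT := hDW.diff_sink hDj
  have hjT : j ∉ W \ {j} := fun h => h.2 rfl
  have hpaC : {p | C.graph.Adj p j} ⊆ W \ {j} := fun p hp =>
    ⟨hCW p j hp hjW, fun e => hCj j hjW (by rw [Set.mem_singleton_iff] at e; rwa [e] at hp)⟩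
  have hpaD : {p | D.graph.Adj p j} ⊆ W \ {j} := fun p hp =>
    ⟨hDW p j hp hjW, fun e => hDj j hjW (by rw [Set.mem_singleton_iff] at e; rwa [e] at hp)⟩
  refine C.false_of_assignProb_ae_eq hpos hmin hij fun B hB =>
    ⟨D.assignProb j B, (D.measurable_assignProb hB).mono (coordSigma_le Ω _) le_rfl,
      fun t y => D.assignProb_congr fun v hv => ?_, fun x => ?_⟩
  · exact Function.update_of_ne (fun h => hDij (by rwa [h] at hv)) _ _
  · refine C.assignProb_ae_eq_of_law_inter hji hCT hjT hpaC hB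
      ((D.measurable_assignProb hB).mono (coordSigma_mono fun p hp => ⟨hpaD hp, ?_⟩) le_rfl)
      fun A hA => ?_
    · rintro rfl
      exact hDij hp
    · rw [hID, D.law_inter (by simp [hji]) hDT hjT hpaD (coordSigma_mono Set.sdiff_subset _ hA) hB]

/-- Models with the same single-node interventions have the same graph: common sinks are removed
one after the other, and the parents of each of them are the same. -/
theorem graph_eq_of_interventionalDistanceZero (hCpos : HasPositiveDensity μ C.obsLaw)
    (hDpos : HasPositiveDensity μ D.obsLaw) (hCmin : CausallyMinimal C.graph C.obsLaw)
    (hDmin : CausallyMinimal D.graph D.obsLaw) (hID : InterventionalDistanceZero C D) :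
    C.graph = D.graph := by
  have hID' : InterventionalDistanceZero D C := fun i x => (hID i x).symm
  suffices H : ∀ (n : ℕ) (W : Set V), W.ncard = n → IsAncestral C.graph W →
      IsAncestral D.graph W → ∀ j ∈ W, ∀ i, C.graph.Adj i j ↔ D.graph.Adj i j by
    ext i j
    exact H _ Set.univ rfl (fun _ _ _ _ => trivial) (fun _ _ _ _ => trivial) j trivial i
  intro n
  induction n with
  | zero =>
    intro W hn _ _ j hj
    rw [(Set.ncard_eq_zero (Set.toFinite W)).1 hn] at hj
    exact hj.elim
  | succ n ih =>
    intro W hn hCW hDW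
    obtain ⟨s, hsW, hCs⟩ := exists_sink C.acyclic (W := W) (by
      rw [← Set.ncard_pos (Set.toFinite W), hn]; omega)
    have hDs := sink_of_interventionalDistanceZero hDpos hDmin hID hCW hDW hCs
    have hcard : (W \ {s}).ncard = n := by
      rw [Set.ncard_sdiff_singleton_of_mem hsW, hn]; rfl
    intro j hj i
    by_cases hjs : j = s
    · subst hjs
      exact ⟨adj_of_interventionalDistanceZero hCpos hCmin hID hCW hDW hsW hCs hDs,
        adj_of_interventionalDistanceZero hDpos hDmin hID' hDW hCW hsW hDs hCs⟩
    · exact ih _ hcard (hCW.diff_sink hCs) (hDW.diff_sink hDs) j ⟨hj, hjs⟩ i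

end Compare

end SCM

theorem mainTheorem1 {V : Type*} [Fintype V] [DecidableEq V] {Ω : V → Type u}
    [∀ v, MeasurableSpace (Ω v)] [∀ v, StandardBorelSpace (Ω v)]
    (μ : ∀ v, Measure (Ω v)) [∀ v, SigmaFinite (μ v)]
    (C : SCM.{u, w₁} V Ω) (D : SCM.{u, w₂} V Ω)
    (hCpos : CausalModel.HasPositiveDensity μ C.obsLaw)
    (hDpos : CausalModel.HasPositiveDensity μ D.obsLaw)
    (hCmin : CausalModel.CausallyMinimal C.graph C.obsLaw)
    (hDmin : CausalModel.CausallyMinimal D.graph D.obsLaw)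
    (hID : CausalModel.InterventionalDistanceZero C D) :
    C.graph = D.graph ∧
      CausalModel.SHD C.graph D.graph = 0 ∧ CausalModel.SID C.graph D.graph = 0 := by
  have hgraph := SCM.graph_eq_of_interventionalDistanceZero hCpos hDpos hCmin hDmin hID
  refine ⟨hgraph, ?_, ?_⟩
  · rw [← hgraph, CausalModel.SHD_self]
  · rw [← hgraph, CausalModel.SID_self fun v h => C.acyclic v (Relation.TransGen.single h)]
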